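/- Let $d\in\mathbb N$, $U_d:=\mathbb R_+^d\setminus\{0\}$, and let $(d,c,\beta,B,\nu,\mu)$ be a set of admissible parameters: $c,\beta\in\mathbb R_+^d$; $B=(b_{i,j})\in\mathbb R^{d\times d}$ is essentially non-negative (has non-negative off-diagonal entries); $\nu$ is a Borel measure on $U_d$ with $\int_{U_d}(1\wedge\|z\|)\,\nu(dz)<\infty$; and $\mu=(\mu_1,\dots,\mu_d)$, where each $\mu_i$ is a Borel measure on $U_d$ with $\int_{U_d}\bigl[\|z\|\wedge\|z\|^2+\sum_{j\ne i}z_j\bigr]\mu_i(dz)<\infty$. Let $(X_t)_{t\ge 0}$ be a multi-type CBI process with these parameters, i.e. a Markov process with state space $\mathbb R_+^d$ whose transition semigroup is the conservative semigroup on $\mathbb R_+^d$ with infinitesimal generator (in the supremum norm) $$(\mathcal A f)(x)=\sum_{i=1}^d c_i x_i f''_{i,i}(x)+\langle\beta+Bx,f'(x)\rangle+\int_{U_d}\bigl(f(x+z)-f(x)\bigr)\nu(dz)+\sum_{i=1}^d x_i\int_{U_d}\bigl(f(x+z)-f(x)-f'_i(x)(1\wedge z_i)\bigr)\mu_i(dz)$$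 for $f\in C^2_c(\mathbb R_+^d,\mathbb R)$, $x\in\mathbb R_+^d$. Let $n$ be the initial distribution of $X$, and suppose that $\int_{\mathbb R_+^d}\|z\|\,n(dz)<\infty$ and $\int_{U_d}\|z\|\mathbf 1_{\{\|z\|\ge1\}}\,\nu(dz)<\infty$. Put $$\tilde\beta:=\beta+\int_{U_d}z\,\nu(dz),\qquad \tilde B=(\tilde b_{i,j}),\quad \tilde b_{i,j}:=b_{i,j}+\int_{U_d}(z_i-\delta_{i,j})^+\,\mu_j(dz).$$ Then these integrals are finite, $\tilde\beta\in\mathbb R_+^d$, $\tilde B$ is essentially non-negative, and for all $t\ge0$ the random vector $X_t$ is integrable with $$\mathbb E(X_t)=e^{t\tilde B}\,\mathbb E(X_0)+\Bigl(\int_0^t e^{u\tilde B}\,du\Bigr)\tilde\beta .$$ In particular, $\int_0^t\mathbb E(\|X_s\|)\,ds<\infty$ for all $t\ge0$. -/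

import Mathlib

open MeasureTheory ProbabilityTheory Filter Topology
open scoped NNReal Matrix

noncomputable section

namespace CBI

/-- `ℝ^d` with the Euclidean norm. -/
abbrev E (d : ℕ) : Type := EuclideanSpace ℝ (Fin d)

/-- The state space `ℝ_+^d`, with its subspace topology and Borel σ-algebra. -/
abbrev Orthant (d : ℕ) : Type := {x : E d // ∀ i, 0 ≤ x i}

/-- The jump space `U_d = ℝ_+^d \ {0}`, with its subspace topology and Borel σ-algebra. -/
abbrev U (d : ℕ) : Type := {z : E d // (∀ i, 0 ≤ z i) ∧ z ≠ 0}

/-- Essentially non-negative matrices: the off-diagonal entries are non-negative. -/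
def EssentiallyNonneg {d : ℕ} (A : Matrix (Fin d) (Fin d) ℝ) : Prop :=
  ∀ i j, i ≠ j → 0 ≤ A i j

/-- Sets of admissible parameters `(d, c, β, B, ν, μ)`. -/
structure AdmissibleParams (d : ℕ) where
  c : Fin d → ℝ
  β : Fin d → ℝ
  B : Matrix (Fin d) (Fin d) ℝ
  ν : Measure (U d)
  μ : Fin d → Measure (U d)
  d_pos : 0 < d
  c_nonneg : ∀ i, 0 ≤ c i
  β_nonneg : ∀ i, 0 ≤ β i
  B_essentiallyNonneg : EssentiallyNonneg B
  ν_integrable : Integrable (fun z : U d => min 1 ‖(z : E d)‖) ν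
  μ_integrable : ∀ i, Integrable
    (fun z : U d => min ‖(z : E d)‖ (‖(z : E d)‖ ^ 2)
      + ∑ j ∈ Finset.univ.erase i, (z : E d) j) (μ i)

namespace AdmissibleParams

variable {d : ℕ} (p : AdmissibleParams d)

/-- The moment condition `∫ ‖z‖ 1_{‖z‖ ≥ 1} ν(dz) < ∞`. -/
def MomentCondition : Prop :=
  Integrable (({z : U d | 1 ≤ ‖(z : E d)‖}).indicator fun z => ‖(z : E d)‖) p.ν

/-- The modified immigration vector: `β̃ = β + ∫ z ν(dz)`. -/
def βTilde : Fin d → ℝ := fun i => p.β i + ∫ z : U d, (z : E d) i ∂p.ν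

/-- The modified branching matrix: `b̃_{i,j} = b_{i,j} + ∫ (z_i - δ_{i,j})^+ μ_j(dz)`. -/
def BTilde : Matrix (Fin d) (Fin d) ℝ := Matrix.of fun i j =>
  p.B i j + ∫ z : U d, max ((z : E d) i - if i = j then 1 else 0) 0 ∂(p.μ j)

end AdmissibleParams

/-- The partial derivative of `f` with respect to the `i`-th variable. -/
def partialDeriv {d : ℕ} (i : Fin d) (f : E d → ℝ) (x : E d) : ℝ :=
  fderiv ℝ f x (EuclideanSpace.single i 1)

/-- `f` represents an element of `C²_c(ℝ_+^d, ℝ)`: its restriction to the closed orthant has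
compact support in the orthant, and that restriction is `C²` up to the boundary, which is expressed
by `f` being `C²` on `ℝ^d`. The values of `f` outside the orthant are never used, and the
derivatives on the orthant depend only on the restriction. -/
def IsTestFunction {d : ℕ} (f : E d → ℝ) : Prop :=
  ContDiff ℝ 2 f ∧ ∃ R : ℝ, ∀ x : Orthant d, R < ‖(x : E d)‖ → f x = 0

/-- The integro-differential operator `𝒜` of a multi-type CBI process. -/
def generator {d : ℕ} (p : AdmissibleParams d) (f : E d → ℝ) (x : Orthant d) : ℝ :=
  (∑ i, p.c i * (x : E d) i * partialDeriv i (partialDeriv i f) x)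
    + (∑ i, (p.β i + ∑ j, p.B i j * (x : E d) j) * partialDeriv i f x)
    + (∫ z : U d, (f ((x : E d) + z) - f x) ∂p.ν)
    + ∑ i, (x : E d) i *
        ∫ z : U d, (f ((x : E d) + z) - f x - partialDeriv i f x * min 1 ((z : E d) i)) ∂(p.μ i)

/-- `(P_t)` is the conservative transition semigroup on `ℝ_+^d` whose infinitesimal generator
(with respect to the supremum norm) is `𝒜` on `C²_c(ℝ_+^d, ℝ)`. -/
structure IsCBISemigroup {d : ℕ} (p : AdmissibleParams d)
    (P : ℝ≥0 → Kernel (Orthant d) (Orthant d)) : Prop where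
  conservative : ∀ t, IsMarkovKernel (P t)
  zero : P 0 = Kernel.id
  add : ∀ s t, P (s + t) = P t ∘ₖ P s
  generator_eq : ∀ f : E d → ℝ, IsTestFunction f →
    TendstoUniformly
      (fun (t : ℝ≥0) (x : Orthant d) => ((∫ y : Orthant d, f y ∂(P t x)) - f x) / (t : ℝ))
      (generator p f) (𝓝[>] 0)

/-- The σ-algebra generated by `X_u`, `u ≤ s`. -/
@[reducible] def past {Ω S : Type*} [MeasurableSpace S] (X : ℝ≥0 → Ω → S) (s : ℝ≥0) : MeasurableSpace Ω :=
  ⨆ u : Set.Iic s, MeasurableSpace.comap (X u) inferInstance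

/-- `X` is a (time homogeneous) Markov process with transition semigroup `(P_t)`, with respect to
its natural filtration. -/
structure IsMarkovProcess {Ω S : Type*} [MeasurableSpace Ω] [MeasurableSpace S]
    (Pr : Measure Ω) (P : ℝ≥0 → Kernel S S) (X : ℝ≥0 → Ω → S) : Prop where
  measurable : ∀ t, Measurable (X t)
  markov : ∀ (s t : ℝ≥0) (A : Set S), MeasurableSet A →
    Pr[(X (s + t) ⁻¹' A).indicator (fun _ => (1 : ℝ)) | past X s]
      =ᵐ[Pr] fun ω => (P t (X s ω)).real A

/-- `X` is a multi-type CBI process with the parameters `p`. -/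
def IsCBIProcess {Ω : Type*} [MeasurableSpace Ω] {d : ℕ} (Pr : Measure Ω)
    (p : AdmissibleParams d) (X : ℝ≥0 → Ω → Orthant d) : Prop :=
  ∃ P : ℝ≥0 → Kernel (Orthant d) (Orthant d), IsCBISemigroup p P ∧ IsMarkovProcess Pr P X

/-- The matrix `∫_0^t e^{uA} du`, the integral being taken entrywise. -/
def expIntegral {d : ℕ} (A : Matrix (Fin d) (Fin d) ℝ) (t : ℝ) : Matrix (Fin d) (Fin d) ℝ :=
  Matrix.of fun i j => ∫ u in (0 : ℝ)..t, (NormedSpace.exp (u • A)) i j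

end CBI

end

/-!
The first moment of a multi-type CBI process is computed from its generator alone.

The laws `m t` of the process are transported by the transition semigroup, so for a test function
`f` the map `t ↦ ∫ f d(m t)` has the right derivative `∫ 𝒜 f d(m t)`, uniformly in `t`
(`hasUniformRightDeriv_of_generator`). As `𝒜 f` is a uniform limit of bounded difference quotients,
it is bounded, and Dynkin's formula is the fundamental theorem of calculus for Lipschitz functions
with a right derivative (`HasUniformRightDeriv.integral`).

The formula has to be extended from test functions to linear functionals `⟨a, x⟩`. This is done with
the concave truncations `cap ε ⟨a, x⟩`, which are constant outside a compact subset of the orthant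
when all `a i ≥ 1`, hence differ from a test function by a constant (`capTest`). On the linear
functional itself the generator is formally `⟨a, β̃ + B̃ x⟩` (`drift`), and concavity gives
`𝒜 (cap ε ⟨a, ·⟩) ≤ cap' · drift ≤ K (1 + cap ε ⟨a, ·⟩)` (`capGen_le`). Grönwall's inequality and
Fatou's lemma then show that first moments stay bounded on compact time intervals
(`exists_integral_lin_le`). Once they are known to be finite, the bound `|𝒜 (cap ε ⟨a, ·⟩)| ≤
K (1 + ⟨a, x⟩)`, uniform in `ε` (`exists_abs_capGen_le`), permits passing to the limit `ε → 0` by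
dominated convergence (`integral_lin_sub`).

The coordinates are differences of such functionals, so the vector of first moments solves the
integral equation of `u' = β̃ + B̃ u`, whose only solution is given by the variation-of-constants
formula (`eq_variation_of_constants`).
-/

noncomputable section

namespace CBI

/-! ### Uniform first-order expansions and Dynkin's formula -/

section FirstOrderExpansion

/-- `G` is the right derivative of `F`, and the first-order expansion is uniform in the
base point. -/
def HasUniformRightDeriv (F G : ℝ≥0 → ℝ) : Prop :=
  ∀ η > 0, ∃ δ > 0, ∀ h : ℝ≥0, 0 < h → (h : ℝ) < δ →
    ∀ t, |F (t + h) - F t - h * G t| ≤ η * h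

variable {F G : ℝ≥0 → ℝ} {C : ℝ}

/-- A bounded right derivative that is attained uniformly forces continuity from both sides. -/
theorem HasUniformRightDeriv.continuous (hFG : HasUniformRightDeriv F G) (hG : ∀ t, |G t| ≤ C) :
    Continuous F := by
  obtain ⟨δ, hδ, hF⟩ := hFG 1 one_pos
  have hC : 0 ≤ C := (abs_nonneg _).trans (hG 0)
  have key : ∀ s t : ℝ≥0, s ≤ t → dist s t < δ → |F t - F s| ≤ (1 + C) * dist s t := by
    intro s t hst hd
    rcases hst.eq_or_lt with rfl | hlt
    · simp
    obtain ⟨h, rfl⟩ := exists_add_of_le hst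
    have hh : 0 < h := by simpa using hlt
    have hdist : dist s (s + h) = h := by
      rw [NNReal.dist_eq]; push_cast
      rw [sub_add_cancel_left, abs_neg, abs_of_nonneg h.coe_nonneg]
    rw [hdist] at hd ⊢
    have h1 := abs_le.1 (hF h hh hd s)
    have h2 := abs_le.1 (hG s)
    have h3 : (0 : ℝ) < h := hh
    rw [abs_le]
    constructor <;> nlinarith [h1.1, h1.2, mul_le_mul_of_nonneg_left h2.1 h3.le,
      mul_le_mul_of_nonneg_left h2.2 h3.le]
  refine UniformContinuous.continuous (Metric.uniformContinuous_iff.2 fun ε hε => ?_)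
  refine ⟨min δ (ε / (1 + C)), by positivity, fun a b hab => ?_⟩
  have hb : (1 + C) * dist a b < ε := by
    have := hab.trans_le (min_le_right _ _)
    rw [lt_div_iff₀ (by positivity)] at this
    linarith
  have hd := hab.trans_le (min_le_left _ _)
  rw [Real.dist_eq]
  rcases le_total a b with h | h
  · rw [abs_sub_comm]
    exact (key a b h hd).trans_lt hb
  · rw [dist_comm] at hd hb
    exact (key b a h hd).trans_lt hb

theorem HasUniformRightDeriv.hasDerivWithinAt
    (hFG : HasUniformRightDeriv F G) (t : ℝ≥0) :
    HasDerivWithinAt (fun s : ℝ => F s.toNNReal) (G t) (Set.Ici (t : ℝ)) t := by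
  rw [hasDerivWithinAt_iff_isLittleO, Asymptotics.isLittleO_iff]
  intro η hη
  obtain ⟨δ, hδ, hF⟩ := hFG η hη
  have : Set.Ico (t : ℝ) (t + δ) ∈ 𝓝[≥] (t : ℝ) := Ico_mem_nhdsGE (by linarith)
  filter_upwards [this] with s hs
  rcases hs.1.eq_or_lt with rfl | hlt
  · simp
  have hlt' : 0 < s - t := by linarith
  have h1 := hF (s - t).toNNReal (by simpa using hlt)
    (by rw [Real.coe_toNNReal _ hlt'.le]; linarith [hs.2]) t
  have h2 : t + (s - t).toNNReal = s.toNNReal := by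
    apply NNReal.eq
    rw [NNReal.coe_add, Real.coe_toNNReal _ hlt'.le, Real.coe_toNNReal _ (t.coe_nonneg.trans hs.1)]
    ring
  rw [h2, Real.coe_toNNReal _ hlt'.le] at h1
  rw [Real.toNNReal_coe, smul_eq_mul, Real.norm_eq_abs, Real.norm_eq_abs, abs_of_pos hlt']
  exact h1

theorem HasUniformRightDeriv.integral (hFG : HasUniformRightDeriv F G) (hG : ∀ t, |G t| ≤ C)
    (t : ℝ≥0) :
    IntervalIntegrable (fun s : ℝ => G s.toNNReal) volume 0 t ∧
      ∫ s in (0 : ℝ)..t, G s.toNNReal = F t - F 0 := by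
  have hderiv : ∀ s : ℝ, 0 ≤ s →
      HasDerivWithinAt (fun s : ℝ => F s.toNNReal) (G s.toNNReal) (Set.Ici s) s := by
    intro s hs
    have := hFG.hasDerivWithinAt s.toNNReal
    rwa [Real.coe_toNNReal _ hs] at this
  have hint : IntervalIntegrable (fun s : ℝ => G s.toNNReal) volume 0 t := by
    rw [intervalIntegrable_iff_integrableOn_Ioc_of_le t.coe_nonneg]
    -- `G` need not be continuous; it is measurable because it is a right derivative.
    refine Integrable.of_bound ?_ C (ae_of_all _ fun s => hG _)
    refine (aestronglyMeasurable_derivWithin_Ici (fun s : ℝ => F s.toNNReal)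
      (volume.restrict (Set.Ioc 0 (t : ℝ)))).congr ?_
    filter_upwards [ae_restrict_mem measurableSet_Ioc] with s hs
    exact (hderiv s hs.1.le).derivWithin (uniqueDiffOn_Ici s s Set.self_mem_Ici)
  refine ⟨hint, ?_⟩
  have := intervalIntegral.integral_eq_sub_of_hasDeriv_right_of_le (f := fun s : ℝ => F s.toNNReal)
    t.coe_nonneg ((hFG.continuous hG).comp continuous_real_toNNReal).continuousOn
    (fun s hs => (hderiv s hs.1.le).mono Set.Ioi_subset_Ici_self) hint
  simpa using this

end FirstOrderExpansion

section Dynkin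

variable {S : Type*} [MeasurableSpace S] {P : ℝ≥0 → Kernel S S} {m : ℝ≥0 → Measure S}
  {f g : S → ℝ} {K : ℝ}

theorem measurable_of_generator (hP : ∀ t, IsMarkovKernel (P t)) (hf : Measurable f)
    (hg : TendstoUniformly (fun (t : ℝ≥0) (x : S) => ((∫ y, f y ∂(P t x)) - f x) / (t : ℝ))
      g (𝓝[>] 0)) : Measurable g := by
  refine measurable_of_tendsto_metrizable' (𝓝[>] (0 : ℝ≥0))
    (f := fun (t : ℝ≥0) (x : S) => ((∫ y, f y ∂(P t x)) - f x) / (t : ℝ)) (fun t => ?_) ?_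
  · have := hP t
    exact ((hf.stronglyMeasurable.integral_kernel (κ := P t)).measurable.sub hf).div_const _
  · exact tendsto_pi_nhds.2 fun x => hg.tendsto_at x

theorem abs_integral_le_of_abs_le {μ : Measure S} [IsProbabilityMeasure μ] (hK : ∀ x, |f x| ≤ K) :
    |∫ x, f x ∂μ| ≤ K := by
  simpa using norm_integral_le_of_norm_le_const (μ := μ) (f := f) (ae_of_all _ hK)

/-- A uniform limit of the difference quotients of a bounded function is bounded, because each
single difference quotient is. -/
theorem bounded_of_generator (hP : ∀ t, IsMarkovKernel (P t)) (hK : ∀ x, |f x| ≤ K)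
    (hg : TendstoUniformly (fun (t : ℝ≥0) (x : S) => ((∫ y, f y ∂(P t x)) - f x) / (t : ℝ))
      g (𝓝[>] 0)) : ∃ C, ∀ x, |g x| ≤ C := by
  obtain ⟨t, ht, htpos⟩ :=
    ((Metric.tendstoUniformly_iff.1 hg 1 one_pos).and self_mem_nhdsWithin).exists
  refine ⟨1 + (K + K) / t, fun x => ?_⟩
  have := hP t
  have h1 := ht x
  rw [Real.dist_eq] at h1
  have h2 : |((∫ y, f y ∂(P t x)) - f x) / (t : ℝ)| ≤ (K + K) / t := by
    rw [abs_div, abs_of_nonneg t.coe_nonneg]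
    gcongr
    exact (abs_sub _ _).trans (add_le_add (abs_integral_le_of_abs_le hK) (hK x))
  calc |g x| = |(g x - ((∫ y, f y ∂(P t x)) - f x) / (t : ℝ))
        + ((∫ y, f y ∂(P t x)) - f x) / (t : ℝ)| := by ring_nf
    _ ≤ 1 + (K + K) / t := (abs_add_le _ _).trans (add_le_add h1.le h2)

theorem integrable_of_abs_le {μ : Measure S} [IsProbabilityMeasure μ] (hf : Measurable f)
    (hK : ∀ x, |f x| ≤ K) : Integrable f μ :=
  Integrable.of_bound hf.aestronglyMeasurable K (ae_of_all _ hK)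

/-- Along a flow of laws `m` that is driven by the semigroup `P`, the integral of a function `f` in
the domain of the generator is differentiable from the right, uniformly in time. -/
theorem hasUniformRightDeriv_of_generator (hP : ∀ t, IsMarkovKernel (P t))
    (hm : ∀ t, IsProbabilityMeasure (m t)) (hPm : ∀ s t, m (s + t) = P t ∘ₘ m s)
    (hf : Measurable f) (hK : ∀ x, |f x| ≤ K)
    (hg : TendstoUniformly (fun (t : ℝ≥0) (x : S) => ((∫ y, f y ∂(P t x)) - f x) / (t : ℝ))
      g (𝓝[>] 0)) :
    HasUniformRightDeriv (fun t => ∫ x, f x ∂(m t)) (fun t => ∫ x, g x ∂(m t)) := by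
  intro η hη
  have h1 := Metric.tendstoUniformly_iff.1 hg η hη
  rw [eventually_nhdsWithin_iff, Metric.eventually_nhds_iff] at h1
  obtain ⟨δ, hδ, h1⟩ := h1
  refine ⟨δ, hδ, fun h hh hhδ t => ?_⟩
  have hh' : (0 : ℝ) < h := hh
  have := hP h
  have := hm t
  have := hm (t + h)
  obtain ⟨C, hC⟩ := bounded_of_generator hP hK hg
  have hgm := measurable_of_generator hP hf hg
  have hPf : Measurable fun x => ∫ y, f y ∂(P h x) :=
    (hf.stronglyMeasurable.integral_kernel (κ := P h)).measurable
  have hPfK : ∀ x, |∫ y, f y ∂(P h x)| ≤ K := fun x => abs_integral_le_of_abs_le hK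
  have hint : ∫ x, f x ∂(m (t + h)) = ∫ x, ∫ y, f y ∂(P h x) ∂(m t) := by
    have hi : Integrable f (m (t + h)) := integrable_of_abs_le hf hK
    rw [hPm] at hi ⊢
    rw [Measure.comp_eq_comp_const_apply] at hi ⊢
    rw [Kernel.integral_comp hi, Kernel.const_apply]
  have hI1 : Integrable (fun x => ∫ y, f y ∂(P h x)) (m t) := integrable_of_abs_le hPf hPfK
  have hI2 : Integrable f (m t) := integrable_of_abs_le hf hK
  have hI3 : Integrable g (m t) := integrable_of_abs_le hgm hC
  have hsub : Integrable (fun x => ∫ y, f y ∂(P h x) - f x) (m t) := hI1.sub hI2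
  dsimp only
  rw [hint, ← integral_sub hI1 hI2, ← integral_const_mul, ← integral_sub hsub (hI3.const_mul _)]
  refine abs_integral_le_of_abs_le fun x => ?_
  have h2 := h1 (y := h) (by rw [NNReal.dist_eq]; simpa using hhδ) hh x
  rw [dist_comm, Real.dist_eq] at h2
  have h3 : (∫ y, f y ∂(P h x)) - f x - h * g x
      = (((∫ y, f y ∂(P h x)) - f x) / (h : ℝ) - g x) * h := by
    field_simp
  rw [h3, abs_mul, abs_of_pos hh']
  gcongr

end Dynkin

/-! ### A concave truncation of the identity -/

/-- A concave `C²` function on `ℝ` that is constant on `[1/ε, ∞)`, vanishes at `0`, and increases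
to the identity on `[0, ∞)` as `ε ↓ 0`. -/
def cap (ε r : ℝ) : ℝ := (1 - max (1 - ε * r) 0 ^ 3) / (3 * ε)

section Cap

variable {ε r y : ℝ}

theorem hasDerivAt_max_zero_pow (n : ℕ) (x : ℝ) :
    HasDerivAt (fun u : ℝ => max u 0 ^ (n + 2)) ((n + 2) * max x 0 ^ (n + 1)) x := by
  rcases lt_trichotomy x 0 with hx | rfl | hx
  · have h : (fun u : ℝ => max u 0 ^ (n + 2)) =ᶠ[𝓝 x] fun _ => 0 := by
      filter_upwards [Iio_mem_nhds hx] with u hu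
      simp [max_eq_right (le_of_lt (Set.mem_Iio.1 hu))]
    rw [max_eq_right hx.le]
    simpa using (hasDerivAt_const x (0 : ℝ)).congr_of_eventuallyEq h
  · rw [hasDerivAt_iff_isLittleO]
    have h : (fun u : ℝ => u ^ (n + 2)) =o[𝓝 0] fun u : ℝ => u := by
      simpa using Asymptotics.isLittleO_pow_pow (𝕜 := ℝ) (m := 1) (n := n + 2) (by omega)
    refine (Asymptotics.IsBigO.of_bound 1 (Eventually.of_forall fun u => ?_)).trans_isLittleO
      (h.congr_right fun u => (sub_zero u).symm)
    simp only [max_self, ne_eq, Nat.add_eq_zero_iff, OfNat.ofNat_ne_zero, one_ne_zero, and_false,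
      not_false_eq_true, zero_pow, mul_zero, smul_zero, sub_zero, norm_pow, one_mul]
    gcongr
    simp only [Real.norm_eq_abs]
    rw [abs_of_nonneg (le_max_right _ _)]
    exact max_le (le_abs_self _) (abs_nonneg _)
  · have h : (fun u : ℝ => max u 0 ^ (n + 2)) =ᶠ[𝓝 x] fun u => u ^ (n + 2) := by
      filter_upwards [Ioi_mem_nhds hx] with u hu
      rw [max_eq_left (le_of_lt hu)]
    rw [max_eq_left hx.le]
    simpa using (hasDerivAt_pow (n + 2) x).congr_of_eventuallyEq h

theorem contDiff_max_zero_cube : ContDiff ℝ 2 fun u : ℝ => max u 0 ^ 3 := by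
  have h1 : deriv (fun u : ℝ => max u 0 ^ 3) = fun u => 3 * max u 0 ^ 2 := by
    ext x; rw [(hasDerivAt_max_zero_pow 1 x).deriv]; norm_num
  have h2 : deriv (fun u : ℝ => 3 * max u 0 ^ 2) = fun u => 3 * (2 * max u 0) := by
    ext x
    have := (hasDerivAt_max_zero_pow 0 x).const_mul 3
    simp only [zero_add, CharP.cast_eq_zero, pow_one] at this
    exact this.deriv
  rw [show (2 : WithTop ℕ∞) = 1 + 1 by norm_num, contDiff_succ_iff_deriv]
  refine ⟨fun x => (hasDerivAt_max_zero_pow 1 x).differentiableAt, by simp, ?_⟩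
  rw [h1, contDiff_one_iff_deriv]
  refine ⟨fun x => ((hasDerivAt_max_zero_pow 0 x).const_mul 3).differentiableAt, ?_⟩
  rw [h2]
  fun_prop

theorem hasDerivAt_cap (hε : 0 < ε) (r : ℝ) : HasDerivAt (cap ε) (max (1 - ε * r) 0 ^ 2) r := by
  have h0 : HasDerivAt (fun r : ℝ => 1 - ε * r) (-ε) r := by
    simpa using ((hasDerivAt_id r).const_mul ε).const_sub 1
  have h := (((hasDerivAt_max_zero_pow 1 (1 - ε * r)).comp r h0).const_sub 1).div_const (3 * ε)
  refine h.congr_deriv ?_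
  norm_num
  field_simp

theorem hasDerivAt_cap_deriv (r : ℝ) :
    HasDerivAt (fun r => max (1 - ε * r) 0 ^ 2) (-(2 * ε * max (1 - ε * r) 0)) r := by
  have h0 : HasDerivAt (fun r : ℝ => 1 - ε * r) (-ε) r := by
    simpa using ((hasDerivAt_id r).const_mul ε).const_sub 1
  have h := (hasDerivAt_max_zero_pow 0 (1 - ε * r)).comp r h0
  refine h.congr_deriv ?_
  norm_num
  ring

theorem contDiff_cap : ContDiff ℝ 2 (cap ε) := by
  unfold cap
  exact (contDiff_const.sub (contDiff_max_zero_cube.comp (by fun_prop))).div_const _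

/-- The slope of `cap ε` at `r` is the square of `max (1 - ε * r) 0`. -/
theorem cap_slope_nonneg : 0 ≤ max (1 - ε * r) 0 := le_max_right _ _

theorem cap_slope_le_one (hε : 0 < ε) (hr : 0 ≤ r) : max (1 - ε * r) 0 ≤ 1 :=
  max_le (by nlinarith [mul_nonneg hε.le hr]) zero_le_one

theorem cap_mono (hε : 0 < ε) : Monotone (cap ε) := by
  intro r s h
  unfold cap
  gcongr

theorem cap_zero : cap ε 0 = 0 := by simp [cap]

theorem cap_nonneg (hε : 0 < ε) (hr : 0 ≤ r) : 0 ≤ cap ε r := by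
  simpa [cap_zero] using cap_mono hε hr

/-- Concavity: the graph lies below its tangents. -/
theorem cap_add_sub_le (hε : 0 < ε) (hy : 0 ≤ y) :
    cap ε (r + y) - cap ε r ≤ max (1 - ε * r) 0 ^ 2 * y := by
  unfold cap
  rw [← sub_div, div_le_iff₀ (by positivity)]
  have hδ : 0 ≤ ε * y := by positivity
  rcases le_total (1 - ε * r) 0 with h | h
  · rw [max_eq_right h, max_eq_right (by linarith)]
    simp
  rw [max_eq_left h]
  rcases le_total (1 - ε * (r + y)) 0 with h' | h'
  · rw [max_eq_right h']
    nlinarith [mul_le_mul_of_nonneg_left (show 1 - ε * r ≤ ε * y by linarith) (sq_nonneg (1 - ε * r)),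
      mul_nonneg hδ (sq_nonneg (1 - ε * r))]
  · rw [max_eq_left h']
    obtain ⟨q, hq⟩ : ∃ q, q = 1 - ε * r := ⟨_, rfl⟩
    obtain ⟨δ, hd⟩ : ∃ δ, δ = ε * y := ⟨_, rfl⟩
    -- In terms of `q` and `δ` the claim is `q³ - (q - δ)³ ≤ 3 q² δ`.
    have e1 : 1 - ε * (r + y) = q - δ := by rw [hq, hd]; ring
    rw [e1] at h' ⊢
    rw [← hq] at h ⊢
    rw [← hd] at hδ
    have e2 : q ^ 2 * y * (3 * ε) = 3 * q ^ 2 * δ := by rw [hd]; ring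
    rw [e2]
    nlinarith [mul_nonneg (mul_nonneg hδ hδ) (show 0 ≤ 3 * q - δ by linarith)]

/-- Taylor's formula of first order, with the error controlled by `|cap''| ≤ 2 ε`. -/
theorem le_cap_add_sub (hε : 0 < ε) (hr : 0 ≤ r) (hy : 0 ≤ y) :
    max (1 - ε * r) 0 ^ 2 * y - ε * y ^ 2 ≤ cap ε (r + y) - cap ε r := by
  unfold cap
  rw [← sub_div, le_div_iff₀ (by positivity)]
  have hδ : 0 ≤ ε * y := by positivity
  have hq1 := cap_slope_le_one hε hr
  rcases le_total (1 - ε * r) 0 with h | h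
  · rw [max_eq_right h, max_eq_right (by linarith)]
    nlinarith [mul_nonneg hδ hδ]
  rw [max_eq_left h] at *
  obtain ⟨q, hq⟩ : ∃ q, q = 1 - ε * r := ⟨_, rfl⟩
  obtain ⟨δ, hd⟩ : ∃ δ, δ = ε * y := ⟨_, rfl⟩
  have e1 : 1 - ε * (r + y) = q - δ := by rw [hq, hd]; ring
  have e2 : (q ^ 2 * y - ε * y ^ 2) * (3 * ε) = 3 * q ^ 2 * δ - 3 * δ ^ 2 := by rw [hd]; ring
  rw [← hq] at h hq1
  rw [e1, ← hq]
  rw [← hd] at hδ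
  rw [e2]
  rcases le_total (q - δ) 0 with h' | h'
  · rw [max_eq_right h']
    nlinarith [mul_nonneg hδ (mul_nonneg h (sub_nonneg.2 hq1)), pow_nonneg h 3,
      mul_nonneg hδ (show 0 ≤ δ - q by linarith)]
  · rw [max_eq_left h']
    nlinarith [mul_nonneg (sq_nonneg δ) (sub_nonneg.2 hq1), pow_nonneg hδ 3]

theorem cap_le_self (hε : 0 < ε) (hr : 0 ≤ r) : cap ε r ≤ r := by
  have := cap_add_sub_le (r := 0) hε hr
  simpa [cap_zero] using this

/-- The tangent at `r` of the concave function `cap ε` is non-negative at `0`. -/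
theorem cap_slope_mul_le (hε : 0 < ε) (hr : 0 ≤ r) : max (1 - ε * r) 0 ^ 2 * r ≤ cap ε r := by
  rcases le_total (1 - ε * r) 0 with h | h
  · rw [max_eq_right h]
    simpa using cap_nonneg hε hr
  unfold cap
  rw [le_div_iff₀ (by positivity), max_eq_left h]
  obtain ⟨q, hq⟩ : ∃ q, q = 1 - ε * r := ⟨_, rfl⟩
  have e2 : (1 - ε * r) ^ 2 * r * (3 * ε) = 3 * q ^ 2 * (1 - q) := by rw [hq]; ring
  rw [e2, ← hq]
  rw [← hq] at h
  nlinarith [mul_nonneg (sq_nonneg (1 - q)) (show 0 ≤ 1 + 2 * q by linarith)]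

theorem sub_le_cap (hε : 0 < ε) (hr : 0 ≤ r) : r - ε * r ^ 2 ≤ cap ε r := by
  have := le_cap_add_sub (r := 0) hε le_rfl hr
  simpa [cap_zero] using this

variable {e : ℕ → ℝ}

theorem tendsto_cap (he : ∀ k, 0 < e k) (he0 : Tendsto e atTop (𝓝 0)) (hr : 0 ≤ r) :
    Tendsto (fun k => cap (e k) r) atTop (𝓝 r) := by
  refine tendsto_of_tendsto_of_tendsto_of_le_of_le (g := fun k => r - e k * r ^ 2) ?_
    tendsto_const_nhds (fun k => sub_le_cap (he k) hr) (fun k => cap_le_self (he k) hr)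
  simpa using (he0.mul_const (r ^ 2)).const_sub r

theorem tendsto_cap_slope (he0 : Tendsto e atTop (𝓝 0)) :
    Tendsto (fun k => max (1 - e k * r) 0) atTop (𝓝 1) := by
  have h : Tendsto (fun k => 1 - e k * r) atTop (𝓝 1) := by
    simpa using (he0.mul_const r).const_sub 1
  simpa using h.max (tendsto_const_nhds (x := (0 : ℝ)))

end Cap

/-! ### Integrability of the coordinates of the jumps -/

section Jumps

variable {d : ℕ}

theorem coord_le_norm (x : E d) (i : Fin d) : x i ≤ ‖x‖ :=
  (le_abs_self _).trans (by simpa using PiLp.norm_apply_le x i)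

theorem norm_le_sum_coord (x : E d) (hx : ∀ i, 0 ≤ x i) : ‖x‖ ≤ ∑ i, x i := by
  rw [EuclideanSpace.norm_eq]
  refine Real.sqrt_le_iff.2 ⟨Finset.sum_nonneg fun i _ => hx i, ?_⟩
  simp only [Real.norm_eq_abs, sq_abs]
  exact Finset.sum_sq_le_sq_sum_of_nonneg fun i _ => hx i

theorem measurable_coord (i : Fin d) : Measurable fun z : U d => (z : E d) i := by fun_prop

namespace AdmissibleParams

variable (p : AdmissibleParams d)

theorem integrable_coord_ν (hν : p.MomentCondition) (i : Fin d) :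
    Integrable (fun z : U d => (z : E d) i) p.ν := by
  refine (p.ν_integrable.add hν).mono' (measurable_coord i).aestronglyMeasurable
    (ae_of_all _ fun z => ?_)
  rw [Real.norm_eq_abs, abs_of_nonneg (z.2.1 i)]
  refine (coord_le_norm _ i).trans ?_
  simp only [Pi.add_apply, Set.indicator_apply, Set.mem_ofPred_eq]
  split_ifs with h
  · have : 0 ≤ min 1 ‖(z : E d)‖ := by positivity
    linarith
  · rw [min_eq_right (not_le.1 h).le, add_zero]

theorem integrable_excess_μ (i j : Fin d) :
    Integrable (fun z : U d => max ((z : E d) i - if i = j then 1 else 0) 0) (p.μ j) := by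
  refine (p.μ_integrable j).mono'
    (((measurable_coord i).sub_const _).max measurable_const).aestronglyMeasurable
    (ae_of_all _ fun z => ?_)
  rw [Real.norm_eq_abs, abs_of_nonneg (le_max_right _ _)]
  have hz := z.2.1
  have h1 : 0 ≤ min ‖(z : E d)‖ (‖(z : E d)‖ ^ 2) := by positivity
  have h2 : 0 ≤ ∑ k ∈ Finset.univ.erase j, (z : E d) k := Finset.sum_nonneg fun k _ => hz k
  refine max_le ?_ (by positivity)
  split_ifs with h
  · by_cases h3 : 1 ≤ (z : E d) i
    · have h4 := coord_le_norm (z : E d) i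
      have h5 : ‖(z : E d)‖ ≤ ‖(z : E d)‖ ^ 2 := by nlinarith
      rw [min_eq_left h5]
      linarith
    · linarith
  · have := Finset.single_le_sum (f := fun k => (z : E d) k) (fun k _ => hz k)
      (Finset.mem_erase.2 ⟨h, Finset.mem_univ i⟩)
    linarith

theorem integrable_min_sq_μ (j : Fin d) :
    Integrable (fun z : U d => min 1 ((z : E d) j) ^ 2) (p.μ j) := by
  refine (p.μ_integrable j).mono'
    ((measurable_const.min (measurable_coord j)).pow_const 2).aestronglyMeasurable
    (ae_of_all _ fun z => ?_)
  have hz := z.2.1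
  have h2 : 0 ≤ ∑ k ∈ Finset.univ.erase j, (z : E d) k := Finset.sum_nonneg fun k _ => hz k
  have h0 : 0 ≤ min 1 ((z : E d) j) := le_min zero_le_one (hz j)
  have h4 := (min_le_right 1 ((z : E d) j)).trans (coord_le_norm (z : E d) j)
  have h5 := min_le_left 1 ((z : E d) j)
  rw [Real.norm_eq_abs, abs_of_nonneg (by positivity)]
  refine le_add_of_le_of_nonneg (le_min ?_ ?_) h2
  · nlinarith
  · gcongr

theorem βTilde_nonneg (i : Fin d) : 0 ≤ p.βTilde i :=
  add_nonneg (p.β_nonneg i) (integral_nonneg fun z => z.2.1 i)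

theorem BTilde_essentiallyNonneg : EssentiallyNonneg p.BTilde := fun i j hij =>
  add_nonneg (p.B_essentiallyNonneg i j hij) (integral_nonneg fun _ => le_max_right _ _)

end AdmissibleParams

end Jumps

/-! ### The generator on truncated linear functionals -/

section Linear

variable {d : ℕ}

/-- The linear functional `x ↦ ∑ i, a i * x i`. -/
def lin (a : Fin d → ℝ) : E d →L[ℝ] ℝ := ∑ i, a i • (EuclideanSpace.proj i : E d →L[ℝ] ℝ)

theorem lin_apply (a : Fin d → ℝ) (x : E d) : lin a x = ∑ i, a i * x i := by
  simp [lin]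

theorem lin_single (a : Fin d → ℝ) (i : Fin d) : lin a (EuclideanSpace.single i 1) = a i := by
  simp [lin_apply]

theorem sum_coord_le_lin {a : Fin d → ℝ} (ha : ∀ i, 1 ≤ a i) {x : E d} (hx : ∀ i, 0 ≤ x i) :
    ∑ i, x i ≤ lin a x := by
  rw [lin_apply]
  exact Finset.sum_le_sum fun i _ => le_mul_of_one_le_left (hx i) (ha i)

theorem lin_nonneg {a : Fin d → ℝ} (ha : ∀ i, 1 ≤ a i) {x : E d} (hx : ∀ i, 0 ≤ x i) :
    0 ≤ lin a x :=
  (Finset.sum_nonneg fun i _ => hx i).trans (sum_coord_le_lin ha hx)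

theorem mul_coord_le_lin {a : Fin d → ℝ} (ha : ∀ i, 1 ≤ a i) {x : E d} (hx : ∀ i, 0 ≤ x i)
    (i : Fin d) : a i * x i ≤ lin a x := by
  rw [lin_apply]
  exact Finset.single_le_sum (f := fun i => a i * x i)
    (fun k _ => mul_nonneg (zero_le_one.trans (ha k)) (hx k)) (Finset.mem_univ i)

theorem partialDeriv_comp_lin (a : Fin d → ℝ) {φ φ' : ℝ → ℝ} (hφ : ∀ r, HasDerivAt φ (φ' r) r)
    (i : Fin d) :
    partialDeriv i (fun x => φ (lin a x)) = fun x => φ' (lin a x) * a i := by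
  ext x
  have h := (hφ (lin a x)).comp_hasFDerivAt x (lin a).hasFDerivAt
  have h' : fderiv ℝ (fun x => φ (lin a x)) x = φ' (lin a x) • lin a := h.fderiv
  simp [partialDeriv, h', lin_single]

/-- The truncated linear functional `cap ε ⟨a, x⟩`, turned upside down so that it has compact
support in the orthant. -/
def capTest (ε : ℝ) (a : Fin d → ℝ) (x : E d) : ℝ := 1 / (3 * ε) - cap ε (lin a x)

theorem isTestFunction_capTest {ε : ℝ} (hε : 0 < ε) {a : Fin d → ℝ} (ha : ∀ i, 1 ≤ a i) :
    IsTestFunction (capTest ε a) := by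
  refine ⟨contDiff_const.sub (contDiff_cap.comp (lin a).contDiff), 1 / ε, fun x hx => ?_⟩
  have h := hx.le.trans ((norm_le_sum_coord _ x.2).trans (sum_coord_le_lin ha x.2))
  rw [div_le_iff₀ hε] at h
  rw [capTest, cap, max_eq_right (by linarith)]
  simp

/-- The negative of the generator applied to `capTest ε a`, in explicit form. -/
def capGen (p : AdmissibleParams d) (ε : ℝ) (a : Fin d → ℝ) (x : Orthant d) : ℝ :=
  -(2 * ε * max (1 - ε * lin a x) 0) * (∑ i, p.c i * (x : E d) i * a i ^ 2)
    + max (1 - ε * lin a x) 0 ^ 2 * (∑ i, (p.β i + ∑ j, p.B i j * (x : E d) j) * a i)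
    + (∫ z : U d, (cap ε (lin a x + lin a z) - cap ε (lin a x)) ∂p.ν)
    + ∑ i, (x : E d) i * ∫ z : U d, (cap ε (lin a x + lin a z) - cap ε (lin a x)
        - max (1 - ε * lin a x) 0 ^ 2 * (a i * min 1 ((z : E d) i))) ∂(p.μ i)

theorem generator_capTest (p : AdmissibleParams d) {ε : ℝ} (hε : 0 < ε) (a : Fin d → ℝ)
    (x : Orthant d) : generator p (capTest ε a) x = -capGen p ε a x := by
  have h1 : ∀ i, partialDeriv i (capTest ε a) = fun x => -(max (1 - ε * lin a x) 0 ^ 2) * a i :=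
    fun i => partialDeriv_comp_lin a (φ := fun r => 1 / (3 * ε) - cap ε r)
      (fun r => (hasDerivAt_cap hε r).const_sub _) i
  have h2 : ∀ i, partialDeriv i (fun x => -(max (1 - ε * lin a x) 0 ^ 2) * a i)
      = fun x => (2 * ε * max (1 - ε * lin a x) 0 * a i) * a i := fun i =>
    partialDeriv_comp_lin a (φ := fun r => -(max (1 - ε * r) 0 ^ 2) * a i)
      (φ' := fun r => 2 * ε * max (1 - ε * r) 0 * a i)
      (fun r => ((hasDerivAt_cap_deriv r).neg.mul_const (a i)).congr_deriv (by ring)) i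
  simp only [generator, h1, h2, capGen, capTest, neg_add, map_add]
  congr 1
  · congr 1
    · congr 1
      · rw [neg_mul, neg_neg, Finset.mul_sum]
        exact Finset.sum_congr rfl fun i _ => by ring
      · rw [Finset.mul_sum, ← Finset.sum_neg_distrib]
        exact Finset.sum_congr rfl fun i _ => by ring
    · rw [← integral_neg]
      exact integral_congr_ae (ae_of_all _ fun z => by ring)
  · rw [← Finset.sum_neg_distrib]
    refine Finset.sum_congr rfl fun i _ => ?_
    rw [← mul_neg, ← integral_neg]
    congr 1
    exact integral_congr_ae (ae_of_all _ fun z => by ring)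

/-- The formal generator on the linear functional `⟨a, x⟩`, namely `⟨a, β̃ + B̃ x⟩`. -/
def drift (p : AdmissibleParams d) (a : Fin d → ℝ) (x : E d) : ℝ :=
  ∑ i, a i * (p.βTilde i + ∑ j, p.BTilde i j * x j)

variable (p : AdmissibleParams d)

theorem lin_sub_min (a : Fin d → ℝ) {z : E d} (hz : ∀ i, 0 ≤ z i) (j : Fin d) :
    lin a z - a j * min 1 (z j) = ∑ i, a i * max (z i - if i = j then 1 else 0) 0 := by
  have h : ∀ i, a i * max (z i - if i = j then 1 else 0) 0
      = a i * z i - if i = j then a i * min 1 (z i) else 0 := by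
    intro i
    split_ifs with hij
    · rw [← mul_sub]
      congr 1
      rcases le_total 1 (z i) with h1 | h1
      · rw [max_eq_left (by linarith), min_eq_left h1]
      · rw [max_eq_right (by linarith), min_eq_right h1, sub_self]
    · rw [sub_zero, sub_zero, max_eq_left (hz i)]
  rw [lin_apply, Finset.sum_congr rfl fun i _ => h i, Finset.sum_sub_distrib,
    Finset.sum_ite_eq' Finset.univ j]
  simp

theorem integrable_lin_ν (hν : p.MomentCondition) (a : Fin d → ℝ) :
    Integrable (fun z : U d => lin a z) p.ν := by
  simp only [lin_apply]
  exact integrable_finsetSum _ fun i _ => (p.integrable_coord_ν hν i).const_mul _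

theorem integrable_lin_sub_min_μ (a : Fin d → ℝ) (j : Fin d) :
    Integrable (fun z : U d => lin a z - a j * min 1 ((z : E d) j)) (p.μ j) := by
  have h : (fun z : U d => lin a z - a j * min 1 ((z : E d) j))
      = fun z : U d => ∑ i, a i * max ((z : E d) i - if i = j then 1 else 0) 0 :=
    funext fun z => lin_sub_min a z.2.1 j
  rw [h]
  exact integrable_finsetSum _ fun i _ => (p.integrable_excess_μ i j).const_mul _

/-- The drift of `⟨a, x⟩` splits into its linear and its jump parts as `capGen` does. -/
theorem drift_eq (hν : p.MomentCondition) (a : Fin d → ℝ) (x : E d) :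
    drift p a x = (∑ i, (p.β i + ∑ j, p.B i j * x j) * a i) + (∫ z : U d, lin a z ∂p.ν)
      + ∑ j, x j * ∫ z : U d, (lin a z - a j * min 1 ((z : E d) j)) ∂(p.μ j) := by
  have h1 : ∫ z : U d, lin a z ∂p.ν = ∑ i, a i * ∫ z : U d, (z : E d) i ∂p.ν := by
    simp only [lin_apply]
    rw [integral_finsetSum _ fun i _ => (p.integrable_coord_ν hν i).const_mul _]
    simp only [integral_const_mul]
  have h2 : ∀ j, ∫ z : U d, (lin a z - a j * min 1 ((z : E d) j)) ∂(p.μ j)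
      = ∑ i, a i * ∫ z : U d, max ((z : E d) i - if i = j then 1 else 0) 0 ∂(p.μ j) := by
    intro j
    rw [integral_congr_ae (ae_of_all _ fun z : U d => lin_sub_min a z.2.1 j),
      integral_finsetSum _ fun i _ => (p.integrable_excess_μ i j).const_mul _]
    simp only [integral_const_mul]
  simp only [h1, h2, drift, AdmissibleParams.βTilde, AdmissibleParams.BTilde, Matrix.of_apply,
    Finset.mul_sum]
  rw [Finset.sum_comm (γ := Fin d), ← Finset.sum_add_distrib, ← Finset.sum_add_distrib]
  refine Finset.sum_congr rfl fun i _ => ?_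
  rw [mul_add, mul_add, Finset.mul_sum, add_mul, Finset.sum_mul]
  have h3 : ∀ j, a i * ((p.B i j + ∫ z : U d, max ((z : E d) i - if i = j then 1 else 0) 0 ∂(p.μ j))
      * x j) = p.B i j * x j * a i
        + x j * (a i * ∫ z : U d, max ((z : E d) i - if i = j then 1 else 0) 0 ∂(p.μ j)) :=
    fun j => by ring
  simp only [h3, Finset.sum_add_distrib]
  ring

section Bounds

variable {p} {ε : ℝ} {a : Fin d → ℝ} {x : Orthant d}

theorem measurable_capIncrement (ε s : ℝ) (a : Fin d → ℝ) :
    Measurable fun z : U d => cap ε (s + lin a z) - cap ε s := by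
  have h := (contDiff_cap (ε := ε)).continuous
  exact Continuous.measurable (by fun_prop)

theorem abs_capIncrement_le (hε : 0 < ε) (ha : ∀ i, 1 ≤ a i) {s : ℝ} (hs : 0 ≤ s) {z : E d}
    (hz : ∀ i, 0 ≤ z i) : |cap ε (s + lin a z) - cap ε s| ≤ lin a z := by
  have h0 := lin_nonneg ha hz
  rw [abs_of_nonneg (sub_nonneg.2 (cap_mono hε (by linarith)))]
  refine (cap_add_sub_le hε h0).trans (mul_le_of_le_one_left h0 ?_)
  exact pow_le_one₀ cap_slope_nonneg (cap_slope_le_one hε hs)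

theorem compensated_le (hε : 0 < ε) (ha : ∀ i, 1 ≤ a i) {s : ℝ} {z : E d}
    (hz : ∀ i, 0 ≤ z i) (j : Fin d) :
    cap ε (s + lin a z) - cap ε s - max (1 - ε * s) 0 ^ 2 * (a j * min 1 (z j))
      ≤ max (1 - ε * s) 0 ^ 2 * (lin a z - a j * min 1 (z j)) := by
  have := cap_add_sub_le (r := s) hε (lin_nonneg ha hz)
  linarith

/-- The compensated increment is dominated uniformly in the truncation. From below, only the
second-order Taylor term of the compensated coordinate survives, as the other coordinates
contribute non-negatively. -/
theorem abs_compensated_le (hε : 0 < ε) (hε1 : ε ≤ 1) (ha : ∀ i, 1 ≤ a i) {s : ℝ} (hs : 0 ≤ s)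
    {z : E d} (hz : ∀ i, 0 ≤ z i) (j : Fin d) :
    |cap ε (s + lin a z) - cap ε s - max (1 - ε * s) 0 ^ 2 * (a j * min 1 (z j))|
      ≤ (lin a z - a j * min 1 (z j)) + a j ^ 2 * min 1 (z j) ^ 2 := by
  have haj : 0 ≤ a j := zero_le_one.trans (ha j)
  have hm : 0 ≤ min 1 (z j) := le_min zero_le_one (hz j)
  have h0 : a j * min 1 (z j) ≤ lin a z :=
    (mul_le_mul_of_nonneg_left (min_le_right _ _) haj).trans (mul_coord_le_lin ha hz j)
  have hq : max (1 - ε * s) 0 ^ 2 ≤ 1 := pow_le_one₀ cap_slope_nonneg (cap_slope_le_one hε hs)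
  have hsq : 0 ≤ a j ^ 2 * min 1 (z j) ^ 2 := by positivity
  rw [abs_le]
  constructor
  · have h1 := le_cap_add_sub hε hs (mul_nonneg haj hm)
    have h2 := cap_mono hε (add_le_add_right h0 s)
    have h3 : ε * (a j * min 1 (z j)) ^ 2 ≤ a j ^ 2 * min 1 (z j) ^ 2 := by
      rw [mul_pow]; exact mul_le_of_le_one_left hsq hε1
    linarith
  · have h1 := compensated_le (s := s) hε ha hz j
    have h2 : max (1 - ε * s) 0 ^ 2 * (lin a z - a j * min 1 (z j)) ≤ lin a z - a j * min 1 (z j) :=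
      mul_le_of_le_one_left (sub_nonneg.2 h0) hq
    linarith

theorem measurable_compensated (ε s q : ℝ) (a : Fin d → ℝ) (j : Fin d) :
    Measurable fun z : U d =>
      cap ε (s + lin a z) - cap ε s - q * (a j * min 1 ((z : E d) j)) :=
  (measurable_capIncrement ε s a).sub
    ((measurable_const.min (measurable_coord j)).const_mul _ |>.const_mul _)

theorem integrable_capIncrement (hν : p.MomentCondition) (hε : 0 < ε) (ha : ∀ i, 1 ≤ a i) {s : ℝ}
    (hs : 0 ≤ s) : Integrable (fun z : U d => cap ε (s + lin a z) - cap ε s) p.ν :=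
  (integrable_lin_ν p hν a).mono' (measurable_capIncrement ε s a).aestronglyMeasurable
    (ae_of_all _ fun z => abs_capIncrement_le hε ha hs z.2.1)

theorem integrable_compensatedBound (p : AdmissibleParams d) (a : Fin d → ℝ) (j : Fin d) :
    Integrable (fun z : U d => (lin a z - a j * min 1 ((z : E d) j))
      + a j ^ 2 * min 1 ((z : E d) j) ^ 2) (p.μ j) :=
  (integrable_lin_sub_min_μ p a j).add ((p.integrable_min_sq_μ j).const_mul _)

theorem integrable_compensated (p : AdmissibleParams d) (hε : 0 < ε) (hε1 : ε ≤ 1)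
    (ha : ∀ i, 1 ≤ a i) {s : ℝ} (hs : 0 ≤ s) (j : Fin d) :
    Integrable (fun z : U d => cap ε (s + lin a z) - cap ε s
      - max (1 - ε * s) 0 ^ 2 * (a j * min 1 ((z : E d) j))) (p.μ j) :=
  (integrable_compensatedBound p a j).mono' (measurable_compensated ε s _ a j).aestronglyMeasurable
    (ae_of_all _ fun z => abs_compensated_le hε hε1 ha hs z.2.1 j)

/-- Concavity of the truncation bounds its generator by the truncated drift. -/
theorem capGen_le (hν : p.MomentCondition) (hε : 0 < ε) (hε1 : ε ≤ 1) (ha : ∀ i, 1 ≤ a i) :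
    capGen p ε a x ≤ max (1 - ε * lin a x) 0 ^ 2 * drift p a x := by
  have hs := lin_nonneg ha x.2
  rw [drift_eq p hν, mul_add, mul_add, capGen]
  have h1 : -(2 * ε * max (1 - ε * lin a x) 0) * (∑ i, p.c i * (x : E d) i * a i ^ 2) ≤ 0 := by
    rw [neg_mul]
    refine neg_nonpos.2 (mul_nonneg (mul_nonneg (by positivity) cap_slope_nonneg) ?_)
    exact Finset.sum_nonneg fun i _ => mul_nonneg (mul_nonneg (p.c_nonneg i) (x.2 i)) (sq_nonneg _)
  have h2 : (∫ z : U d, (cap ε (lin a x + lin a z) - cap ε (lin a x)) ∂p.ν)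
      ≤ max (1 - ε * lin a x) 0 ^ 2 * ∫ z : U d, lin a z ∂p.ν := by
    rw [← integral_const_mul]
    exact integral_mono (integrable_capIncrement hν hε ha hs) ((integrable_lin_ν p hν a).const_mul _)
      fun z => cap_add_sub_le hε (lin_nonneg ha z.2.1)
  have h3 : (∑ i, (x : E d) i * ∫ z : U d, (cap ε (lin a x + lin a z) - cap ε (lin a x)
        - max (1 - ε * lin a x) 0 ^ 2 * (a i * min 1 ((z : E d) i))) ∂(p.μ i))
      ≤ max (1 - ε * lin a x) 0 ^ 2
        * ∑ j, (x : E d) j * ∫ z : U d, (lin a z - a j * min 1 ((z : E d) j)) ∂(p.μ j) := by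
    rw [Finset.mul_sum]
    refine Finset.sum_le_sum fun i _ => ?_
    rw [mul_left_comm]
    refine mul_le_mul_of_nonneg_left ?_ (x.2 i)
    rw [← integral_const_mul]
    exact integral_mono (integrable_compensated p hε hε1 ha hs i)
      ((integrable_lin_sub_min_μ p a i).const_mul _) fun z => compensated_le hε ha z.2.1 i
  linarith

/-- A non-negative combination of the coordinates is dominated by `⟨a, x⟩`. -/
theorem add_sum_le_linear (ha : ∀ i, 1 ≤ a i) {k : ℝ} {v : Fin d → ℝ} (hk : 0 ≤ k)
    (hv : ∀ i, 0 ≤ v i) : k + ∑ i, (x : E d) i * v i ≤ (k + ∑ i, v i) * (1 + lin a x) := by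
  have h1 : ∑ i, (x : E d) i * v i ≤ lin a x * ∑ i, v i := by
    rw [Finset.mul_sum]
    refine Finset.sum_le_sum fun i _ => mul_le_mul_of_nonneg_right ?_ (hv i)
    exact (Finset.single_le_sum (f := fun i => (x : E d) i) (fun j _ => x.2 j)
      (Finset.mem_univ i)).trans (sum_coord_le_lin ha x.2)
  have h2 : 0 ≤ ∑ i, v i := Finset.sum_nonneg fun i _ => hv i
  nlinarith [lin_nonneg ha x.2]

theorem exists_abs_drift_le (p : AdmissibleParams d) (ha : ∀ i, 1 ≤ a i) :
    ∃ K, 0 ≤ K ∧ ∀ x : Orthant d, |drift p a x| ≤ K * (1 + lin a x) := by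
  have ha0 : ∀ i, 0 ≤ a i := fun i => zero_le_one.trans (ha i)
  refine ⟨(∑ i, a i * |p.βTilde i|) + ∑ j, ∑ i, a i * |p.BTilde i j|, ?_, fun x => ?_⟩
  · exact add_nonneg (Finset.sum_nonneg fun i _ => mul_nonneg (ha0 i) (abs_nonneg _))
      (Finset.sum_nonneg fun j _ => Finset.sum_nonneg fun i _ =>
        mul_nonneg (ha0 i) (abs_nonneg _))
  refine le_trans ?_ (add_sum_le_linear ha
    (Finset.sum_nonneg fun i _ => mul_nonneg (ha0 i) (abs_nonneg _))
    fun j => Finset.sum_nonneg fun i _ => mul_nonneg (ha0 i) (abs_nonneg _))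
  simp only [Finset.mul_sum]
  rw [Finset.sum_comm (γ := Fin d), ← Finset.sum_add_distrib]
  refine (Finset.abs_sum_le_sum_abs _ _).trans (Finset.sum_le_sum fun i _ => ?_)
  rw [abs_mul, abs_of_nonneg (ha0 i)]
  refine (mul_le_mul_of_nonneg_left ((abs_add_le _ _).trans
    (add_le_add_right (Finset.abs_sum_le_sum_abs _ _) _)) (ha0 i)).trans_eq ?_
  rw [mul_add, Finset.mul_sum]
  congr 1
  refine Finset.sum_congr rfl fun j _ => ?_
  rw [abs_mul, abs_of_nonneg (x.2 j)]
  ring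

/-- The generator of the truncations grows at most linearly, uniformly in the truncation. -/
theorem exists_abs_capGen_le (hν : p.MomentCondition) (ha : ∀ i, 1 ≤ a i) :
    ∃ K, 0 ≤ K ∧ ∀ ε, 0 < ε → ε ≤ 1 → ∀ x : Orthant d, |capGen p ε a x| ≤ K * (1 + lin a x) := by
  have ha0 : ∀ i, 0 ≤ a i := fun i => zero_le_one.trans (ha i)
  have hJ : ∀ j, 0 ≤ ∫ z : U d, ((lin a z - a j * min 1 ((z : E d) j))
      + a j ^ 2 * min 1 ((z : E d) j) ^ 2) ∂(p.μ j) := fun j =>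
    integral_nonneg fun z => (abs_nonneg _).trans
      (abs_compensated_le one_pos le_rfl ha le_rfl z.2.1 j)
  have hN : 0 ≤ ∫ z : U d, lin a z ∂p.ν := integral_nonneg fun z => lin_nonneg ha z.2.1
  have hk : 0 ≤ (∑ i, |p.β i| * a i) + ∫ z : U d, lin a z ∂p.ν :=
    add_nonneg (Finset.sum_nonneg fun i _ => mul_nonneg (abs_nonneg _) (ha0 i)) hN
  have hv : ∀ j, 0 ≤ 2 * p.c j * a j ^ 2 + (∑ i, |p.B i j| * a i)
      + ∫ z : U d, ((lin a z - a j * min 1 ((z : E d) j))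
        + a j ^ 2 * min 1 ((z : E d) j) ^ 2) ∂(p.μ j) := fun j =>
    add_nonneg (add_nonneg (mul_nonneg (mul_nonneg zero_le_two (p.c_nonneg j)) (sq_nonneg _))
      (Finset.sum_nonneg fun i _ => mul_nonneg (abs_nonneg _) (ha0 i))) (hJ j)
  refine ⟨_, add_nonneg hk (Finset.sum_nonneg (s := Finset.univ) fun j _ => hv j), fun ε hε hε1 x => ?_⟩
  refine le_trans ?_ (add_sum_le_linear ha hk hv)
  have hs := lin_nonneg ha x.2
  have hq0 : 0 ≤ max (1 - ε * lin a x) 0 := cap_slope_nonneg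
  have hq1 : max (1 - ε * lin a x) 0 ≤ 1 := cap_slope_le_one hε hs
  have h1 : |-(2 * ε * max (1 - ε * lin a x) 0) * (∑ i, p.c i * (x : E d) i * a i ^ 2)|
      ≤ ∑ i, (x : E d) i * (2 * p.c i * a i ^ 2) := by
    have hS : 0 ≤ ∑ i, p.c i * (x : E d) i * a i ^ 2 :=
      Finset.sum_nonneg fun i _ => mul_nonneg (mul_nonneg (p.c_nonneg i) (x.2 i)) (sq_nonneg _)
    rw [neg_mul, abs_neg, abs_of_nonneg (by positivity)]
    have : 2 * ε * max (1 - ε * lin a x) 0 ≤ 2 := by nlinarith [mul_le_one₀ hε1 hq0 hq1]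
    refine (mul_le_mul_of_nonneg_right this hS).trans_eq ?_
    rw [Finset.mul_sum]
    exact Finset.sum_congr rfl fun i _ => by ring
  have h2 : |max (1 - ε * lin a x) 0 ^ 2 * (∑ i, (p.β i + ∑ j, p.B i j * (x : E d) j) * a i)|
      ≤ (∑ i, |p.β i| * a i) + ∑ j, (x : E d) j * ∑ i, |p.B i j| * a i := by
    rw [abs_mul, abs_of_nonneg (by positivity)]
    refine (mul_le_of_le_one_left (abs_nonneg _) (pow_le_one₀ hq0 hq1)).trans ?_
    simp only [Finset.mul_sum]
    rw [Finset.sum_comm (γ := Fin d), ← Finset.sum_add_distrib]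
    refine (Finset.abs_sum_le_sum_abs _ _).trans (Finset.sum_le_sum fun i _ => ?_)
    rw [abs_mul, abs_of_nonneg (ha0 i)]
    refine (mul_le_mul_of_nonneg_right ((abs_add_le _ _).trans
      (add_le_add_right (Finset.abs_sum_le_sum_abs _ _) _)) (ha0 i)).trans_eq ?_
    rw [add_mul, Finset.sum_mul]
    congr 1
    refine Finset.sum_congr rfl fun j _ => ?_
    rw [abs_mul, abs_of_nonneg (x.2 j)]
    ring
  have h3 : |∫ z : U d, (cap ε (lin a x + lin a z) - cap ε (lin a x)) ∂p.ν|
      ≤ ∫ z : U d, lin a z ∂p.ν :=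
    norm_integral_le_of_norm_le
      (f := fun z : U d => cap ε (lin a x + lin a z) - cap ε (lin a x)) (integrable_lin_ν p hν a)
      (ae_of_all _ fun z => abs_capIncrement_le hε ha hs z.2.1)
  have h4 : |∑ i, (x : E d) i * ∫ z : U d, (cap ε (lin a x + lin a z) - cap ε (lin a x)
        - max (1 - ε * lin a x) 0 ^ 2 * (a i * min 1 ((z : E d) i))) ∂(p.μ i)|
      ≤ ∑ j, (x : E d) j * ∫ z : U d, ((lin a z - a j * min 1 ((z : E d) j))
        + a j ^ 2 * min 1 ((z : E d) j) ^ 2) ∂(p.μ j) := by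
    refine (Finset.abs_sum_le_sum_abs _ _).trans (Finset.sum_le_sum fun i _ => ?_)
    rw [abs_mul, abs_of_nonneg (x.2 i)]
    refine mul_le_mul_of_nonneg_left ?_ (x.2 i)
    rw [← Real.norm_eq_abs]
    exact norm_integral_le_of_norm_le (integrable_compensatedBound p a i)
      (ae_of_all _ fun z => abs_compensated_le hε hε1 ha hs z.2.1 i)
  rw [capGen]
  refine (abs_add_le _ _).trans ?_
  refine (add_le_add_left ((abs_add_le _ _).trans (add_le_add_left (abs_add_le _ _) _)) _).trans ?_
  simp only [mul_add, Finset.sum_add_distrib] at h1 h2 h3 h4 ⊢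
  linarith

theorem tendsto_capGen (hν : p.MomentCondition) (ha : ∀ i, 1 ≤ a i) {e : ℕ → ℝ}
    (he : ∀ k, 0 < e k) (he1 : ∀ k, e k ≤ 1) (he0 : Tendsto e atTop (𝓝 0)) (x : Orthant d) :
    Tendsto (fun k => capGen p (e k) a x) atTop (𝓝 (drift p a x)) := by
  have hs := lin_nonneg ha x.2
  have hq := tendsto_cap_slope (r := lin a x) he0
  have hq2 : Tendsto (fun k => max (1 - e k * lin a x) 0 ^ 2) atTop (𝓝 1) := by
    simpa using hq.pow 2
  have hinc : ∀ z : U d, Tendsto (fun k => cap (e k) (lin a x + lin a z) - cap (e k) (lin a x))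
      atTop (𝓝 (lin a z)) := by
    intro z
    have := (tendsto_cap he he0 (add_nonneg hs (lin_nonneg ha z.2.1))).sub (tendsto_cap he he0 hs)
    simpa using this
  rw [drift_eq p hν]
  unfold capGen
  refine Tendsto.add (Tendsto.add ?_ ?_) ?_
  · have h1 := ((he0.const_mul 2).mul hq).neg.mul_const (∑ i, p.c i * (x : E d) i * a i ^ 2)
    have h2 := hq2.mul_const (∑ i, (p.β i + ∑ j, p.B i j * (x : E d) j) * a i)
    simpa using h1.add h2
  · exact tendsto_integral_of_dominated_convergence (fun z : U d => lin a z)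
      (fun k => (measurable_capIncrement (e k) _ a).aestronglyMeasurable) (integrable_lin_ν p hν a)
      (fun k => ae_of_all _ fun z => abs_capIncrement_le (he k) ha hs z.2.1) (ae_of_all _ hinc)
  · refine tendsto_finsetSum _ fun j _ => Tendsto.const_mul _ ?_
    refine tendsto_integral_of_dominated_convergence _
      (fun k => (measurable_compensated (e k) _ _ a j).aestronglyMeasurable)
      (integrable_compensatedBound p a j)
      (fun k => ae_of_all _ fun z => abs_compensated_le (he k) (he1 k) ha hs z.2.1 j)
      (ae_of_all _ fun z => ?_)
    simpa using (hinc z).sub (hq2.mul_const (a j * min 1 ((z : E d) j)))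

end Bounds

end Linear

/-! ### The flow of one-dimensional laws -/

section Flow

variable {d : ℕ} {p : AdmissibleParams d} {P : ℝ≥0 → Kernel (Orthant d) (Orthant d)}
  {m : ℝ≥0 → Measure (Orthant d)} {a : Fin d → ℝ}

/-- A family of probability measures that is transported by the kernels `P`. -/
structure IsLawFlow {S : Type*} [MeasurableSpace S] (P : ℝ≥0 → Kernel S S) (m : ℝ≥0 → Measure S) :
    Prop where
  prob : ∀ t, IsProbabilityMeasure (m t)
  step : ∀ s t, m (s + t) = P t ∘ₘ m s

theorem past_le {Ω S : Type*} [mΩ : MeasurableSpace Ω] [MeasurableSpace S] {X : ℝ≥0 → Ω → S}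
    (hX : ∀ t, Measurable (X t)) (s : ℝ≥0) : past X s ≤ mΩ :=
  iSup_le fun u => (hX u).comap_le

/-- The one-dimensional laws of a Markov process are transported by its transition semigroup. -/
theorem IsMarkovProcess.isLawFlow {Ω S : Type*} [MeasurableSpace Ω] [MeasurableSpace S]
    {Pr : Measure Ω} [IsProbabilityMeasure Pr] {P : ℝ≥0 → Kernel S S} {X : ℝ≥0 → Ω → S}
    (hP : ∀ t, IsMarkovKernel (P t)) (hX : IsMarkovProcess Pr P X) :
    IsLawFlow P fun t => Pr.map (X t) := by
  have hprob : ∀ t, IsProbabilityMeasure (Pr.map (X t)) := fun t =>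
    Measure.isProbabilityMeasure_map (hX.measurable t).aemeasurable
  refine ⟨hprob, fun s t => ?_⟩
  have := hP t
  have := hprob s
  have := hprob (s + t)
  ext A hA
  have hle := past_le hX.measurable s
  have h1 := integral_condExp (μ := Pr)
    (f := (X (s + t) ⁻¹' A).indicator (fun _ => (1 : ℝ))) hle
  have hpA : Measurable fun x => (P t x) A := Kernel.measurable_coe (P t) hA
  rw [integral_congr_ae (hX.markov s t A hA), integral_indicator_const _
    (hX.measurable (s + t) hA), smul_eq_mul, mul_one] at h1
  rw [Measure.bind_apply hA (P t).aemeasurable, lintegral_map hpA (hX.measurable s),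
    Measure.map_apply (hX.measurable (s + t)) hA]
  have h2 : ∫ ω, (P t (X s ω)).real A ∂Pr = (∫⁻ ω, P t (X s ω) A ∂Pr).toReal := by
    simp only [measureReal_def]
    exact integral_toReal (hpA.comp (hX.measurable s)).aemeasurable
      (ae_of_all _ fun ω => measure_lt_top _ _)
  have h3 : ∫⁻ ω, P t (X s ω) A ∂Pr ≠ ⊤ := by
    refine ne_top_of_le_ne_top ENNReal.one_ne_top ?_
    refine (lintegral_mono fun ω => (prob_le_one : P t (X s ω) A ≤ 1)).trans ?_
    simp
  rw [h2, measureReal_def] at h1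
  exact ((ENNReal.toReal_eq_toReal_iff' h3 (measure_ne_top _ _)).1 h1).symm

theorem IsTestFunction.exists_abs_le {f : E d → ℝ} (hf : IsTestFunction f) :
    ∃ K, ∀ x : Orthant d, |f x| ≤ K := by
  obtain ⟨hc, R, hR⟩ := hf
  obtain ⟨K, hK⟩ := (isCompact_closedBall (0 : E d) R).exists_bound_of_continuousOn
    hc.continuous.continuousOn
  refine ⟨max K 0, fun x => ?_⟩
  by_cases hx : R < ‖(x : E d)‖
  · simp [hR x hx]
  · exact (hK x (by simpa using not_lt.1 hx)).trans (le_max_left _ _)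

theorem IsTestFunction.measurable {f : E d → ℝ} (hf : IsTestFunction f) :
    Measurable fun x : Orthant d => f x :=
  (hf.1.continuous.comp continuous_subtype_val).measurable

theorem IsCBISemigroup.hasUniformRightDeriv (hS : IsCBISemigroup p P) (hm : IsLawFlow P m)
    {f : E d → ℝ} (hf : IsTestFunction f) :
    HasUniformRightDeriv (fun t => ∫ x : Orthant d, f x ∂(m t))
      (fun t => ∫ x, generator p f x ∂(m t)) := by
  obtain ⟨K, hK⟩ := hf.exists_abs_le
  exact hasUniformRightDeriv_of_generator hS.conservative hm.prob hm.step hf.measurable hK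
    (hS.generator_eq f hf)

theorem IsCBISemigroup.exists_abs_generator_le (hS : IsCBISemigroup p P) {f : E d → ℝ}
    (hf : IsTestFunction f) : ∃ C, ∀ x, |generator p f x| ≤ C := by
  obtain ⟨K, hK⟩ := hf.exists_abs_le
  exact bounded_of_generator hS.conservative hK (hS.generator_eq f hf)

theorem IsCBISemigroup.exists_abs_integral_generator_le (hS : IsCBISemigroup p P)
    (hm : IsLawFlow P m) {f : E d → ℝ} (hf : IsTestFunction f) :
    ∃ C, ∀ t, |∫ x, generator p f x ∂(m t)| ≤ C := by
  obtain ⟨C, hC⟩ := hS.exists_abs_generator_le hf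
  refine ⟨C, fun t => ?_⟩
  have := hm.prob t
  exact abs_integral_le_of_abs_le hC

theorem IsCBISemigroup.measurable_generator (hS : IsCBISemigroup p P) {f : E d → ℝ}
    (hf : IsTestFunction f) : Measurable (generator p f) :=
  measurable_of_generator hS.conservative hf.measurable (hS.generator_eq f hf)

theorem IsCBISemigroup.continuous_integral (hS : IsCBISemigroup p P) (hm : IsLawFlow P m)
    {f : E d → ℝ} (hf : IsTestFunction f) : Continuous fun t => ∫ x : Orthant d, f x ∂(m t) := by
  obtain ⟨C, hC⟩ := hS.exists_abs_integral_generator_le hm hf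
  exact (hS.hasUniformRightDeriv hm hf).continuous hC

variable {ε : ℝ}

theorem IsCBISemigroup.measurable_capGen (hS : IsCBISemigroup p P) (hε : 0 < ε)
    (ha : ∀ i, 1 ≤ a i) : Measurable (capGen p ε a) := by
  have h := (hS.measurable_generator (isTestFunction_capTest hε ha)).neg
  have h' : -generator p (capTest ε a) = capGen p ε a := by
    ext x; rw [Pi.neg_apply, generator_capTest p hε, neg_neg]
  rwa [h'] at h

theorem IsCBISemigroup.integrable_capGen (hS : IsCBISemigroup p P) (hm : IsLawFlow P m)
    (hε : 0 < ε) (ha : ∀ i, 1 ≤ a i) (t : ℝ≥0) : Integrable (capGen p ε a) (m t) := by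
  obtain ⟨C, hC⟩ := hS.exists_abs_generator_le (isTestFunction_capTest hε ha)
  have := hm.prob t
  refine integrable_of_abs_le (hS.measurable_capGen hε ha) (K := C) fun x => ?_
  simpa [generator_capTest p hε] using hC x

theorem continuous_cap_lin (ε : ℝ) (a : Fin d → ℝ) :
    Continuous fun x : Orthant d => cap ε (lin a x) :=
  contDiff_cap.continuous.comp ((lin a).continuous.comp continuous_subtype_val)

theorem integrable_cap_lin (hm : IsLawFlow P m) (hε : 0 < ε) (ha : ∀ i, 1 ≤ a i) (t : ℝ≥0) :
    Integrable (fun x : Orthant d => cap ε (lin a x)) (m t) := by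
  have := hm.prob t
  obtain ⟨K, hK⟩ := (isTestFunction_capTest hε ha).exists_abs_le
  refine integrable_of_abs_le (continuous_cap_lin ε a).measurable (K := 1 / (3 * ε) + K) fun x => ?_
  have h : cap ε (lin a x) = 1 / (3 * ε) - capTest ε a x := by simp [capTest]
  rw [h]
  refine (abs_sub _ _).trans (add_le_add ?_ (hK x))
  rw [abs_of_pos (by positivity)]

theorem integral_capTest (hm : IsLawFlow P m) (hε : 0 < ε) (ha : ∀ i, 1 ≤ a i) (t : ℝ≥0) :
    ∫ x : Orthant d, capTest ε a x ∂(m t)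
      = 1 / (3 * ε) - ∫ x : Orthant d, cap ε (lin a x) ∂(m t) := by
  have := hm.prob t
  simp only [capTest]
  rw [integral_sub (integrable_const _) (integrable_cap_lin hm hε ha t)]
  simp

theorem integral_generator_capTest (hε : 0 < ε) (t : ℝ≥0) :
    ∫ x, generator p (capTest ε a) x ∂(m t) = -∫ x, capGen p ε a x ∂(m t) := by
  simp only [generator_capTest p hε, integral_neg]

/-- The truncated linear functionals satisfy the Lyapunov bound `L f ≤ K (1 + f)`, so Grönwall's
inequality bounds their expectations uniformly in the truncation. -/
theorem exists_integral_cap_le (hS : IsCBISemigroup p P) (hm : IsLawFlow P m)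
    (hν : p.MomentCondition) (ha : ∀ i, 1 ≤ a i)
    (h0 : Integrable (fun x : Orthant d => lin a x) (m 0)) (T : ℝ≥0) :
    ∃ C, 0 ≤ C ∧ ∀ ε, 0 < ε → ε ≤ 1 → ∀ t ≤ T, ∫ x : Orthant d, cap ε (lin a x) ∂(m t) ≤ C := by
  obtain ⟨K, hK0, hK⟩ := exists_abs_drift_le p ha
  have hδ : 0 ≤ ∫ x : Orthant d, lin a x ∂(m 0) := integral_nonneg fun x => lin_nonneg ha x.2
  have hmono := gronwallBound_mono hδ hK0 hK0
  refine ⟨gronwallBound (∫ x : Orthant d, lin a x ∂(m 0)) K K T, ?_, fun ε hε hε1 t ht => ?_⟩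
  · refine hδ.trans ?_
    have := hmono T.coe_nonneg
    rwa [gronwallBound_x0] at this
  have hT := isTestFunction_capTest hε ha
  have hcont : Continuous fun t => ∫ x : Orthant d, cap ε (lin a x) ∂(m t) := by
    have : Continuous fun t => 1 / (3 * ε) - ∫ x : Orthant d, capTest ε a x ∂(m t) :=
      continuous_const.sub (hS.continuous_integral hm hT)
    simpa only [integral_capTest hm hε ha, sub_sub_cancel] using this
  have hderiv : ∀ s : ℝ≥0, HasDerivWithinAt
      (fun r : ℝ => ∫ x : Orthant d, cap ε (lin a x) ∂(m r.toNNReal))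
      (∫ x, capGen p ε a x ∂(m s)) (Set.Ici (s : ℝ)) s := by
    intro s
    have h := ((hS.hasUniformRightDeriv hm hT).hasDerivWithinAt s).const_sub
      (1 / (3 * ε))
    simpa only [integral_capTest hm hε ha, sub_sub_cancel, integral_generator_capTest hε,
      neg_neg] using h
  have hbound : ∀ s, ∫ x, capGen p ε a x ∂(m s)
      ≤ K * (∫ x : Orthant d, cap ε (lin a x) ∂(m s)) + K := by
    intro s
    have := hm.prob s
    have hi := integrable_cap_lin hm hε ha s
    have h : K * (∫ x : Orthant d, cap ε (lin a x) ∂(m s)) + K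
        = ∫ x : Orthant d, (K * cap ε (lin a x) + K) ∂(m s) := by
      rw [integral_add (hi.const_mul K) (integrable_const K), integral_const_mul]
      simp
    rw [h]
    refine integral_mono (hS.integrable_capGen hm hε ha s)
      ((hi.const_mul K).add (integrable_const K)) fun x => ?_
    have hs := lin_nonneg ha x.2
    have hq0 : 0 ≤ max (1 - ε * lin a x) 0 ^ 2 := sq_nonneg _
    have hq1 : max (1 - ε * lin a x) 0 ^ 2 ≤ 1 :=
      pow_le_one₀ cap_slope_nonneg (cap_slope_le_one hε hs)
    have h1 := mul_le_mul_of_nonneg_left ((le_abs_self _).trans (hK x)) hq0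
    have h2 := mul_le_mul_of_nonneg_left
      (add_le_add hq1 (cap_slope_mul_le hε hs)) hK0
    exact (capGen_le hν hε hε1 ha).trans (h1.trans (by linarith))
  -- The initial value is bounded by the untruncated moment, so the bound is uniform in `ε`.
  have hgron := le_gronwallBound_of_liminf_deriv_right_le
    (f := fun r : ℝ => ∫ x : Orthant d, cap ε (lin a x) ∂(m r.toNNReal))
    (f' := fun r : ℝ => ∫ x, capGen p ε a x ∂(m r.toNNReal))
    (δ := ∫ x : Orthant d, lin a x ∂(m 0)) (K := K) (ε := K) (a := 0) (b := T)
    (hcont.comp continuous_real_toNNReal).continuousOn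
    (fun r hr q hq => by
      have h := hderiv r.toNNReal
      rw [Real.coe_toNNReal _ hr.1] at h
      exact h.liminf_right_slope_le hq)
    (by
      rw [Real.toNNReal_zero]
      exact integral_mono (integrable_cap_lin hm hε ha 0) h0
        fun x => cap_le_self hε (lin_nonneg ha x.2))
    (fun r _ => hbound _) t ⟨t.coe_nonneg, NNReal.coe_le_coe.2 ht⟩
  simp only [Real.toNNReal_coe, sub_zero] at hgron
  exact hgron.trans (hmono (NNReal.coe_le_coe.2 ht))

/-- The truncation levels `1 / (k + 1)`. -/
def level (k : ℕ) : ℝ := 1 / ((k : ℝ) + 1)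

theorem level_pos (k : ℕ) : 0 < level k := by unfold level; positivity

theorem level_le_one (k : ℕ) : level k ≤ 1 := by
  unfold level
  rw [div_le_one (by positivity)]
  linarith [(Nat.cast_nonneg k : (0 : ℝ) ≤ k)]

theorem tendsto_level : Tendsto level atTop (𝓝 0) := tendsto_one_div_add_atTop_nhds_zero_nat

/-- First moments stay bounded on compact time intervals. -/
theorem exists_integral_lin_le (hS : IsCBISemigroup p P) (hm : IsLawFlow P m)
    (hν : p.MomentCondition) (ha : ∀ i, 1 ≤ a i)
    (h0 : Integrable (fun x : Orthant d => lin a x) (m 0)) (T : ℝ≥0) :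
    ∃ C, 0 ≤ C ∧ ∀ t ≤ T, Integrable (fun x : Orthant d => lin a x) (m t) ∧
      ∫ x : Orthant d, lin a x ∂(m t) ≤ C := by
  obtain ⟨C, hC0, hC⟩ := exists_integral_cap_le hS hm hν ha h0 T
  refine ⟨C, hC0, fun t ht => ?_⟩
  have hmeas : AEStronglyMeasurable (fun x : Orthant d => lin a x) (m t) :=
    ((lin a).continuous.comp continuous_subtype_val).aestronglyMeasurable
  have hnn : 0 ≤ᵐ[m t] fun x : Orthant d => lin a x := ae_of_all _ fun x => lin_nonneg ha x.2
  have hlim : ∀ x : Orthant d,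
      Tendsto (fun k => ENNReal.ofReal (cap (level k) (lin a x))) atTop
        (𝓝 (ENNReal.ofReal (lin a x))) := fun x =>
    ENNReal.tendsto_ofReal (tendsto_cap level_pos tendsto_level (lin_nonneg ha x.2))
  have hfatou : ∫⁻ x : Orthant d, ENNReal.ofReal (lin a x) ∂(m t) ≤ ENNReal.ofReal C := by
    calc ∫⁻ x : Orthant d, ENNReal.ofReal (lin a x) ∂(m t)
        = ∫⁻ x : Orthant d, liminf (fun k => ENNReal.ofReal (cap (level k) (lin a x))) atTop
            ∂(m t) := lintegral_congr fun x => (hlim x).liminf_eq.symm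
      _ ≤ liminf (fun k => ∫⁻ x : Orthant d, ENNReal.ofReal (cap (level k) (lin a x)) ∂(m t))
            atTop := lintegral_liminf_le fun k =>
              (continuous_cap_lin (level k) a).measurable.ennreal_ofReal
      _ ≤ ENNReal.ofReal C := by
          refine liminf_le_of_frequently_le' (Frequently.of_forall fun k => ?_)
          rw [← ofReal_integral_eq_lintegral_ofReal (integrable_cap_lin hm (level_pos k) ha t)
            (ae_of_all _ fun x => cap_nonneg (level_pos k) (lin_nonneg ha x.2))]
          exact ENNReal.ofReal_le_ofReal (hC _ (level_pos k) (level_le_one k) t ht)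
  refine ⟨(lintegral_ofReal_ne_top_iff_integrable hmeas hnn).1
    (ne_top_of_le_ne_top ENNReal.ofReal_ne_top hfatou), ?_⟩
  rw [integral_eq_lintegral_of_nonneg_ae hnn hmeas]
  exact ENNReal.toReal_le_of_le_ofReal hC0 hfatou

/-- Dynkin's formula for linear functionals with coefficients at least `1`, by removing the
truncation under the integrals. -/
theorem integral_lin_sub (hS : IsCBISemigroup p P) (hm : IsLawFlow P m)
    (hν : p.MomentCondition) (ha : ∀ i, 1 ≤ a i)
    (h0 : Integrable (fun x : Orthant d => lin a x) (m 0)) (t : ℝ≥0) :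
    IntervalIntegrable (fun s : ℝ => ∫ x : Orthant d, drift p a x ∂(m s.toNNReal)) volume 0 t ∧
      ∫ s in (0 : ℝ)..t, (∫ x : Orthant d, drift p a x ∂(m s.toNNReal))
        = ∫ x : Orthant d, lin a x ∂(m t) - ∫ x : Orthant d, lin a x ∂(m 0) := by
  obtain ⟨C, hC0, hC⟩ := exists_integral_lin_le hS hm hν ha h0 t
  obtain ⟨K, hK0, hK⟩ := exists_abs_capGen_le hν ha
  have hmK : ∀ s ≤ t, Integrable (fun x : Orthant d => K * (1 + lin a x)) (m s) := fun s hs => by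
    have := hm.prob s
    exact ((integrable_const _).add (hC s hs).1).const_mul _
  have hKC : ∀ s ≤ t, ∫ x : Orthant d, K * (1 + lin a x) ∂(m s) ≤ K * (1 + C) := fun s hs => by
    have := hm.prob s
    rw [integral_const_mul, integral_add (integrable_const _) (hC s hs).1]
    have := (hC s hs).2
    simp only [integral_const, probReal_univ, smul_eq_mul, mul_one]
    gcongr
  have hle : ∀ s : ℝ, s ∈ Set.Ioc 0 (t : ℝ) → s.toNNReal ≤ t := fun s hs =>
    Real.toNNReal_le_iff_le_coe.2 hs.2
  have hbound : ∀ k, ∀ s ≤ t, ‖∫ x, capGen p (level k) a x ∂(m s)‖ ≤ K * (1 + C) :=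
    fun k s hs => (norm_integral_le_of_norm_le (hmK s hs)
      (ae_of_all _ fun x => hK _ (level_pos k) (level_le_one k) x)).trans (hKC s hs)
  have hlim : ∀ s ≤ t, Tendsto (fun k => ∫ x, capGen p (level k) a x ∂(m s)) atTop
      (𝓝 (∫ x : Orthant d, drift p a x ∂(m s))) := fun s hs =>
    tendsto_integral_of_dominated_convergence _
      (fun k => (hS.measurable_capGen (level_pos k) ha).aestronglyMeasurable) (hmK s hs)
      (fun k => ae_of_all _ fun x => hK _ (level_pos k) (level_le_one k) x)
      (ae_of_all _ fun x => tendsto_capGen hν ha level_pos level_le_one tendsto_level x)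
  have hdyn : ∀ k, IntervalIntegrable
        (fun s : ℝ => ∫ x, capGen p (level k) a x ∂(m s.toNNReal)) volume 0 t ∧
      ∫ s in (0 : ℝ)..t, (∫ x, capGen p (level k) a x ∂(m s.toNNReal))
        = ∫ x : Orthant d, cap (level k) (lin a x) ∂(m t)
          - ∫ x : Orthant d, cap (level k) (lin a x) ∂(m 0) := by
    intro k
    have hT := isTestFunction_capTest (level_pos k) ha
    obtain ⟨B, hB⟩ := hS.exists_abs_integral_generator_le hm hT
    have h := (hS.hasUniformRightDeriv hm hT).integral hB t
    simp only [integral_capTest hm (level_pos k) ha, integral_generator_capTest (level_pos k),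
      intervalIntegral.integral_neg] at h
    refine ⟨by simpa [Pi.neg_def] using h.1.neg, ?_⟩
    linarith [h.2]
  have hmeas : ∀ k, AEStronglyMeasurable
      (fun s : ℝ => ∫ x, capGen p (level k) a x ∂(m s.toNNReal))
      (volume.restrict (Set.Ioc 0 (t : ℝ))) := fun k => (hdyn k).1.1.aestronglyMeasurable
  have hcap : ∀ s ≤ t, Tendsto (fun k => ∫ x : Orthant d, cap (level k) (lin a x) ∂(m s)) atTop
      (𝓝 (∫ x : Orthant d, lin a x ∂(m s))) := fun s hs =>
    tendsto_integral_of_dominated_convergence _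
      (fun k => (continuous_cap_lin (level k) a).aestronglyMeasurable) (hC s hs).1
      (fun k => ae_of_all _ fun x => by
        rw [Real.norm_eq_abs, abs_of_nonneg (cap_nonneg (level_pos k) (lin_nonneg ha x.2))]
        exact cap_le_self (level_pos k) (lin_nonneg ha x.2))
      (ae_of_all _ fun x => tendsto_cap level_pos tendsto_level (lin_nonneg ha x.2))
  constructor
  · rw [intervalIntegrable_iff_integrableOn_Ioc_of_le t.coe_nonneg]
    refine Integrable.of_bound (aestronglyMeasurable_of_tendsto_ae atTop hmeas ?_) (K * (1 + C)) ?_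
    · filter_upwards [ae_restrict_mem measurableSet_Ioc] with s hs using hlim _ (hle s hs)
    · filter_upwards [ae_restrict_mem measurableSet_Ioc] with s hs
      exact le_of_tendsto (hlim _ (hle s hs)).norm
        (Eventually.of_forall fun k => hbound k _ (hle s hs))
  · refine tendsto_nhds_unique ?_ ((hcap t le_rfl).sub (hcap 0 t.2))
    simp only [← (hdyn _).2]
    refine intervalIntegral.tendsto_integral_filter_of_dominated_convergence
      (fun _ => K * (1 + C)) (Eventually.of_forall fun k => ?_)
      (Eventually.of_forall fun k => ae_of_all _ fun s hs => ?_) (by simp)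
      (ae_of_all _ fun s hs => ?_)
    · rw [Set.uIoc_of_le t.coe_nonneg]
      exact hmeas k
    · rw [Set.uIoc_of_le t.coe_nonneg] at hs
      exact hbound k _ (hle s hs)
    · rw [Set.uIoc_of_le t.coe_nonneg] at hs
      exact hlim _ (hle s hs)

end Flow

/-! ### Linear integral equations -/

section LinearODE

variable {d : ℕ} (A : Matrix (Fin d) (Fin d) ℝ)

theorem hasDerivAt_exp_entry (t : ℝ) (i j : Fin d) :
    HasDerivAt (fun u : ℝ => NormedSpace.exp (u • A) i j) ((A * NormedSpace.exp (t • A)) i j) t := by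
  -- The exponential only depends on the topology, so any normed algebra structure serves.
  let _ : NormedRing (Matrix (Fin d) (Fin d) ℝ) := Matrix.linftyOpNormedRing
  let _ : NormedAlgebra ℝ (Matrix (Fin d) (Fin d) ℝ) := Matrix.linftyOpNormedAlgebra
  have h := hasDerivAt_exp_smul_const' (𝕂 := ℝ) A t
  exact (Matrix.entryLinearMap ℝ ℝ i j).toContinuousLinearMap.hasFDerivAt.comp_hasDerivAt t h

theorem continuous_exp_entry (i j : Fin d) : Continuous fun u : ℝ => NormedSpace.exp (u • A) i j :=
  continuous_iff_continuousAt.2 fun t => (hasDerivAt_exp_entry A t i j).continuousAt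

theorem hasDerivAt_expIntegral_entry (t : ℝ) (i j : Fin d) :
    HasDerivAt (fun u : ℝ => expIntegral A u i j) (NormedSpace.exp (t • A) i j) t := by
  simp only [expIntegral, Matrix.of_apply]
  exact (continuous_exp_entry A i j).integral_hasStrictDerivAt 0 t |>.hasDerivAt

/-- The integrated form of `(e^{tA})' = A e^{tA}`, valid without inverting `A`. -/
theorem mul_expIntegral (t : ℝ) : A * expIntegral A t = NormedSpace.exp (t • A) - 1 := by
  ext i j
  have hc : ∀ k, Continuous fun u : ℝ => A i k * NormedSpace.exp (u • A) k j := fun k =>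
    continuous_const.mul (continuous_exp_entry A k j)
  have h := intervalIntegral.integral_eq_sub_of_hasDerivAt (a := 0) (b := t)
    (fun u _ => hasDerivAt_exp_entry A u i j) (by
      simp only [Matrix.mul_apply]
      exact (continuous_finsetSum _ fun k _ => hc k).intervalIntegrable _ _)
  simp only [zero_smul, NormedSpace.exp_zero, Matrix.mul_apply] at h
  rw [intervalIntegral.integral_finsetSum fun k _ => (hc k).intervalIntegrable _ _] at h
  rw [Matrix.sub_apply, ← h]
  simp [Matrix.mul_apply, expIntegral]

/-- The variation-of-constants formula solves `w' = b + A w`. -/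
theorem hasDerivAt_variation_of_constants (b v : Fin d → ℝ) (t : ℝ) :
    HasDerivAt (fun u : ℝ => NormedSpace.exp (u • A) *ᵥ v + expIntegral A u *ᵥ b)
      (b + A *ᵥ (NormedSpace.exp (t • A) *ᵥ v + expIntegral A t *ᵥ b)) t := by
  have h : b + A *ᵥ (NormedSpace.exp (t • A) *ᵥ v + expIntegral A t *ᵥ b)
      = (A * NormedSpace.exp (t • A)) *ᵥ v + NormedSpace.exp (t • A) *ᵥ b := by
    rw [Matrix.mulVec_add, Matrix.mulVec_mulVec, Matrix.mulVec_mulVec, mul_expIntegral,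
      Matrix.sub_mulVec, Matrix.one_mulVec]
    abel
  rw [h, hasDerivAt_pi]
  intro i
  simp only [Pi.add_apply, Matrix.mulVec, dotProduct]
  exact (HasDerivAt.fun_sum fun j _ => (hasDerivAt_exp_entry A t i j).mul_const (v j)).add
    (HasDerivAt.fun_sum fun j _ => (hasDerivAt_expIntegral_entry A t i j).mul_const (b j))

/-- A solution of the integral equation `u t = u 0 + ∫₀ᵗ (b + A u s) ds` is given by variation of
constants. Continuity of `u` is a consequence of the equation. -/
theorem eq_variation_of_constants (b : Fin d → ℝ) (u : ℝ≥0 → Fin d → ℝ)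
    (hint : ∀ (t : ℝ≥0) i, IntervalIntegrable (fun s : ℝ => (b + A *ᵥ u s.toNNReal) i) volume 0 t)
    (hu : ∀ (t : ℝ≥0) i, ∫ s in (0 : ℝ)..t, (b + A *ᵥ u s.toNNReal) i = u t i - u 0 i)
    (t : ℝ≥0) :
    u t = NormedSpace.exp ((t : ℝ) • A) *ᵥ u 0 + expIntegral A t *ᵥ b := by
  -- On the negative half-line `s.toNNReal = 0` makes the integrand constant.
  have hint0 : ∀ (t : ℝ) i,
      IntervalIntegrable (fun s : ℝ => (b + A *ᵥ u s.toNNReal) i) volume 0 t := by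
    intro t i
    rcases le_total 0 t with ht | ht
    · simpa [ht] using hint t.toNNReal i
    · refine (intervalIntegrable_const (c := (b + A *ᵥ u 0) i)).congr ?_
      intro s hs
      rw [Set.uIoc_of_ge ht] at hs
      simp [Real.toNNReal_of_nonpos hs.2]
  have hint' : ∀ i (r t : ℝ),
      IntervalIntegrable (fun s : ℝ => (b + A *ᵥ u s.toNNReal) i) volume r t :=
    fun i r t => (hint0 r i).symm.trans (hint0 t i)
  have hcont : ∀ i, Continuous fun s : ℝ => u s.toNNReal i := by
    intro i
    have h1 := intervalIntegral.continuous_primitive (hint' i) 0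
    have h2 : (fun s : ℝ => u s.toNNReal i) = fun s : ℝ =>
        (∫ r in (0 : ℝ)..max s 0, (b + A *ᵥ u r.toNNReal) i) + u 0 i := by
      ext s
      have := hu s.toNNReal i
      rw [Real.coe_toNNReal'] at this
      rw [this]; ring
    rw [h2]
    exact (h1.comp (continuous_id.max continuous_const)).add continuous_const
  have hcontA : ∀ i, Continuous fun s : ℝ => (b + A *ᵥ u s.toNNReal) i := by
    intro i
    simp only [Pi.add_apply, Matrix.mulVec, dotProduct]
    exact continuous_const.add (continuous_finsetSum _ fun j _ => continuous_const.mul (hcont j))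
  -- `v` agrees with `u` on `[0, ∞)` and is differentiable on the whole line, also at `0`.
  let v : ℝ → Fin d → ℝ := fun s i => (∫ r in (0 : ℝ)..s, (b + A *ᵥ u r.toNNReal) i) + u 0 i
  have hvu : ∀ s : ℝ, 0 ≤ s → v s = u s.toNNReal := by
    intro s hs
    ext i
    have := hu s.toNNReal i
    rw [Real.coe_toNNReal _ hs] at this
    simp only [v, this]; ring
  have hv : ∀ s : ℝ, 0 ≤ s → HasDerivAt v (b + A *ᵥ v s) s := by
    intro s hs
    rw [hvu s hs, hasDerivAt_pi]
    intro i
    exact ((hcontA i).integral_hasStrictDerivAt 0 s).hasDerivAt.add_const _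
  let w : ℝ → Fin d → ℝ := fun s => NormedSpace.exp (s • A) *ᵥ u 0 + expIntegral A s *ᵥ b
  have hw : ∀ s, HasDerivAt w (b + A *ᵥ w s) s := hasDerivAt_variation_of_constants A b (u 0)
  have hlip : LipschitzWith ‖A.mulVecLin.toContinuousLinearMap‖₊ fun x => b + A *ᵥ x := by
    simpa using! (LipschitzWith.const b).add A.mulVecLin.toContinuousLinearMap.lipschitz
  have h0 : v 0 = w 0 := by
    have : expIntegral A 0 = 0 := by ext i j; simp [expIntegral]
    ext i
    simp [v, w, this]
  have huniq := ODE_solution_unique (v := fun _ x => b + A *ᵥ x) (f := v) (g := w) (a := 0)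
    (b := t) (fun _ => hlip)
    (fun s hs => (hv s hs.1).continuousAt.continuousWithinAt)
    (fun s hs => (hv s hs.1).hasDerivWithinAt)
    (fun s _ => (hw s).continuousAt.continuousWithinAt)
    (fun s _ => (hw s).hasDerivWithinAt) h0
  have h := huniq ⟨t.coe_nonneg, le_rfl⟩
  rwa [hvu t t.coe_nonneg, Real.toNNReal_coe] at h

end LinearODE

/-! ### First moments of the process -/

section Moments

variable {d : ℕ} {p : AdmissibleParams d} {P : ℝ≥0 → Kernel (Orthant d) (Orthant d)}
  {m : ℝ≥0 → Measure (Orthant d)}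

theorem norm_le_lin_one (x : Orthant d) : ‖(x : E d)‖ ≤ lin 1 (x : E d) :=
  (norm_le_sum_coord _ x.2).trans (sum_coord_le_lin (fun _ => le_rfl) x.2)

theorem integrable_lin_of_norm {μ : Measure (Orthant d)} (a : Fin d → ℝ)
    (h : Integrable (fun x : Orthant d => ‖(x : E d)‖) μ) :
    Integrable (fun x : Orthant d => lin a x) μ :=
  (h.const_mul ‖lin a‖).mono'
    ((lin a).continuous.comp continuous_subtype_val).aestronglyMeasurable
    (ae_of_all _ fun x => (lin a).le_opNorm x)

theorem exists_integral_norm_le (hS : IsCBISemigroup p P) (hm : IsLawFlow P m)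
    (hν : p.MomentCondition) (h0 : Integrable (fun x : Orthant d => ‖(x : E d)‖) (m 0)) (T : ℝ≥0) :
    ∃ C, ∀ t ≤ T, Integrable (fun x : Orthant d => ‖(x : E d)‖) (m t) ∧
      ∫ x : Orthant d, ‖(x : E d)‖ ∂(m t) ≤ C := by
  obtain ⟨C, _, hC⟩ := exists_integral_lin_le (a := 1) hS hm hν (fun _ => le_rfl)
    (integrable_lin_of_norm 1 h0) T
  refine ⟨C, fun t ht => ?_⟩
  have hi : Integrable (fun x : Orthant d => ‖(x : E d)‖) (m t) :=
    (hC t ht).1.mono' continuous_subtype_val.norm.aestronglyMeasurable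
      (ae_of_all _ fun x => by rw [norm_norm]; exact norm_le_lin_one x)
  exact ⟨hi, (integral_mono hi (hC t ht).1 norm_le_lin_one).trans (hC t ht).2⟩

theorem integrable_coord_of_norm {μ : Measure (Orthant d)} (i : Fin d)
    (h : Integrable (fun x : Orthant d => ‖(x : E d)‖) μ) :
    Integrable (fun x : Orthant d => (x : E d) i) μ := by
  simpa [lin_apply, Pi.single_apply] using integrable_lin_of_norm (Pi.single i 1) h

theorem integral_drift {μ : Measure (Orthant d)} [IsProbabilityMeasure μ] (a : Fin d → ℝ)
    (h : Integrable (fun x : Orthant d => ‖(x : E d)‖) μ) :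
    ∫ x : Orthant d, drift p a x ∂μ
      = ∑ i, a i * (p.βTilde + p.BTilde *ᵥ fun j => ∫ x : Orthant d, (x : E d) j ∂μ) i := by
  have h1 : ∀ i, Integrable (fun x : Orthant d => ∑ j, p.BTilde i j * (x : E d) j) μ := fun i =>
    integrable_finsetSum _ fun j _ => (integrable_coord_of_norm j h).const_mul _
  have h2 : ∀ i, ∫ x : Orthant d, ∑ j, p.BTilde i j * (x : E d) j ∂μ
      = ∑ j, p.BTilde i j * ∫ x : Orthant d, (x : E d) j ∂μ := fun i => by
    rw [integral_finsetSum _ fun j _ => (integrable_coord_of_norm j h).const_mul _]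
    simp only [integral_const_mul]
  have h3 : ∀ i, Integrable
      (fun x : Orthant d => a i * (p.βTilde i + ∑ j, p.BTilde i j * (x : E d) j)) μ := fun i =>
    ((integrable_const _).add (h1 i)).const_mul _
  simp only [drift]
  rw [integral_finsetSum _ fun i _ => h3 i]
  refine Finset.sum_congr rfl fun i _ => ?_
  rw [integral_const_mul, integral_add (integrable_const _) (h1 i), h2]
  simp [Matrix.mulVec, dotProduct]

/-- The vector of first moments solves the linear integral equation `u' = β̃ + B̃ u`. The `i`-th
coordinate is the difference of the linear functionals with coefficients `1 + eᵢ` and `1`. -/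
theorem integral_coord_sub (hS : IsCBISemigroup p P) (hm : IsLawFlow P m)
    (hν : p.MomentCondition) (h0 : Integrable (fun x : Orthant d => ‖(x : E d)‖) (m 0)) (t : ℝ≥0)
    (i : Fin d) :
    IntervalIntegrable (fun s : ℝ => (p.βTilde
      + p.BTilde *ᵥ fun j => ∫ x : Orthant d, (x : E d) j ∂(m s.toNNReal)) i) volume 0 t ∧
    ∫ s in (0 : ℝ)..t, (p.βTilde
      + p.BTilde *ᵥ fun j => ∫ x : Orthant d, (x : E d) j ∂(m s.toNNReal)) i
      = ∫ x : Orthant d, (x : E d) i ∂(m t) - ∫ x : Orthant d, (x : E d) i ∂(m 0) := by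
  have hnorm : ∀ s, Integrable (fun x : Orthant d => ‖(x : E d)‖) (m s) := fun s =>
    (exists_integral_norm_le hS hm hν h0 s).elim fun _ h => (h s le_rfl).1
  have ha : ∀ k, (1 : ℝ) ≤ (1 + Pi.single i 1 : Fin d → ℝ) k := fun k => by
    have : (0 : ℝ) ≤ (Pi.single i 1 : Fin d → ℝ) k := by
      rw [Pi.single_apply]; split_ifs <;> norm_num
    simpa using this
  have h1 := integral_lin_sub hS hm hν ha (integrable_lin_of_norm _ h0) t
  have h2 := integral_lin_sub (a := 1) hS hm hν (fun _ => le_rfl) (integrable_lin_of_norm _ h0) t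
  have hdrift : ∀ s : ℝ, ∫ x : Orthant d, drift p (1 + Pi.single i 1) x ∂(m s.toNNReal)
      - ∫ x : Orthant d, drift p 1 x ∂(m s.toNNReal)
      = (p.βTilde + p.BTilde *ᵥ fun j => ∫ x : Orthant d, (x : E d) j ∂(m s.toNNReal)) i := by
    intro s
    have := hm.prob s.toNNReal
    rw [integral_drift _ (hnorm _), integral_drift _ (hnorm _), ← Finset.sum_sub_distrib]
    simp [add_mul, Pi.single_apply]
  have hlin : ∀ s, ∫ x : Orthant d, lin (1 + Pi.single i 1) (x : E d) ∂(m s)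
      - ∫ x : Orthant d, lin 1 (x : E d) ∂(m s) = ∫ x : Orthant d, (x : E d) i ∂(m s) := by
    intro s
    rw [← integral_sub (integrable_lin_of_norm _ (hnorm s)) (integrable_lin_of_norm _ (hnorm s))]
    refine integral_congr_ae (ae_of_all _ fun x => ?_)
    simp [lin_apply, add_mul, Pi.single_apply, Finset.sum_add_distrib]
  constructor
  · simpa only [hdrift] using h1.1.sub h2.1
  · have h := intervalIntegral.integral_sub h1.1 h2.1
    simp only [hdrift] at h
    rw [h, h1.2, h2.2, ← hlin, ← hlin]
    ring

/-- A `C²` approximation `√(‖x‖² + ε)` of the norm, cut off smoothly outside `{⟨1, x⟩ < 1/ε}`. -/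
def normTest (ε : ℝ) (x : E d) : ℝ := Real.sqrt (‖x‖ ^ 2 + ε) * max (1 - ε * lin 1 x) 0 ^ 3

theorem isTestFunction_normTest {ε : ℝ} (hε : 0 < ε) :
    IsTestFunction (normTest ε : E d → ℝ) := by
  refine ⟨ContDiff.mul ?_ (contDiff_max_zero_cube.comp
    (contDiff_const.sub (contDiff_const.mul (lin 1).contDiff))), 1 / ε, fun x hx => ?_⟩
  · exact ((contDiff_norm_sq ℝ).add contDiff_const).sqrt fun x => by positivity
  · have h := hx.le.trans (norm_le_lin_one x)
    rw [div_le_iff₀ hε] at h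
    rw [normTest, max_eq_right (by linarith)]
    simp

theorem abs_normTest_le {ε : ℝ} (hε : 0 < ε) (hε1 : ε ≤ 1) (x : Orthant d) :
    |normTest ε (x : E d)| ≤ ‖(x : E d)‖ + 1 := by
  have hs := lin_nonneg (a := 1) (fun _ => le_rfl) x.2
  rw [normTest, abs_of_nonneg (mul_nonneg (Real.sqrt_nonneg _) (pow_nonneg cap_slope_nonneg _))]
  refine (mul_le_of_le_one_right (Real.sqrt_nonneg _)
    (pow_le_one₀ cap_slope_nonneg (cap_slope_le_one hε hs))).trans ?_
  refine Real.sqrt_le_iff.2 ⟨by positivity, ?_⟩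
  nlinarith [norm_nonneg (x : E d)]

theorem tendsto_normTest (x : E d) : Tendsto (fun k => normTest (level k) x) atTop (𝓝 ‖x‖) := by
  have h1 : Tendsto (fun k => Real.sqrt (‖x‖ ^ 2 + level k)) atTop (𝓝 ‖x‖) := by
    have := (tendsto_level.const_add (‖x‖ ^ 2)).sqrt
    simpa using this
  simpa [normTest] using h1.mul ((tendsto_cap_slope (r := lin 1 x) tendsto_level).pow 3)

/-- The expected norm is bounded on `[0, t]`, and it is measurable in time as a pointwise limit of
the continuous expectations of test functions. -/
theorem intervalIntegrable_integral_norm (hS : IsCBISemigroup p P) (hm : IsLawFlow P m)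
    (hν : p.MomentCondition) (h0 : Integrable (fun x : Orthant d => ‖(x : E d)‖) (m 0))
    (t : ℝ≥0) :
    IntervalIntegrable (fun s : ℝ => ∫ x : Orthant d, ‖(x : E d)‖ ∂(m s.toNNReal)) volume 0 t := by
  obtain ⟨C, hC⟩ := exists_integral_norm_le hS hm hν h0 t
  have hle : ∀ s : ℝ, s ∈ Set.Ioc 0 (t : ℝ) → s.toNNReal ≤ t := fun s hs =>
    Real.toNNReal_le_iff_le_coe.2 hs.2
  rw [intervalIntegrable_iff_integrableOn_Ioc_of_le t.coe_nonneg]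
  refine Integrable.of_bound (aestronglyMeasurable_of_tendsto_ae atTop
    (f := fun k (s : ℝ) => ∫ x : Orthant d, normTest (level k) (x : E d) ∂(m s.toNNReal))
    (fun k => ?_) ?_) C ?_
  · exact ((hS.continuous_integral hm (isTestFunction_normTest (level_pos k))).comp
      continuous_real_toNNReal).aestronglyMeasurable
  · filter_upwards [ae_restrict_mem measurableSet_Ioc] with s hs
    have := hm.prob s.toNNReal
    exact tendsto_integral_of_dominated_convergence _
      (fun k => (isTestFunction_normTest (level_pos k)).measurable.aestronglyMeasurable)
      ((hC _ (hle s hs)).1.add (integrable_const 1))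
      (fun k => ae_of_all _ fun x => abs_normTest_le (level_pos k) (level_le_one k) x)
      (ae_of_all _ fun x => tendsto_normTest (x : E d))
  · filter_upwards [ae_restrict_mem measurableSet_Ioc] with s hs
    rw [Real.norm_eq_abs, abs_of_nonneg (integral_nonneg fun x => norm_nonneg _)]
    exact (hC _ (hle s hs)).2

end Moments

end CBI

end

theorem mainTheorem4 {Ω : Type*} [MeasurableSpace Ω] (Pr : Measure Ω) [IsProbabilityMeasure Pr]
    {d : ℕ} (p : CBI.AdmissibleParams d) (X : ℝ≥0 → Ω → CBI.Orthant d)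
    (n : Measure (CBI.Orthant d))
    (hX : CBI.IsCBIProcess Pr p X)
    (hn : Pr.map (X 0) = n)
    (hn_moment : Integrable (fun x : CBI.Orthant d => ‖(x : CBI.E d)‖) n)
    (hν : p.MomentCondition) :
    ((∀ i, Integrable (fun z : CBI.U d => (z : CBI.E d) i) p.ν) ∧
      (∀ i j, Integrable
        (fun z : CBI.U d => max ((z : CBI.E d) i - if i = j then 1 else 0) 0) (p.μ j)) ∧
      (∀ i, 0 ≤ p.βTilde i) ∧ CBI.EssentiallyNonneg p.BTilde) ∧
    (∀ t : ℝ≥0, Integrable (fun ω => (X t ω : CBI.E d)) Pr ∧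
      ∫ ω, (X t ω : CBI.E d) ∂Pr =
        WithLp.toLp 2
          (NormedSpace.exp ((t : ℝ) • p.BTilde) *ᵥ (∫ ω, (X 0 ω : CBI.E d) ∂Pr).ofLp
            + CBI.expIntegral p.BTilde t *ᵥ p.βTilde)) ∧
    (∀ t : ℝ≥0,
      IntervalIntegrable (fun s : ℝ => ∫ ω, ‖(X s.toNNReal ω : CBI.E d)‖ ∂Pr) volume 0 t) := by
  obtain ⟨P, hS, hM⟩ := hX
  refine ⟨⟨p.integrable_coord_ν hν, p.integrable_excess_μ, p.βTilde_nonneg,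
    p.BTilde_essentiallyNonneg⟩, ?_⟩
  have hm := hM.isLawFlow hS.conservative
  have h0 : Integrable (fun x : CBI.Orthant d => ‖(x : CBI.E d)‖) (Pr.map (X 0)) := by rwa [hn]
  have hnorm : ∀ s, Integrable (fun x : CBI.Orthant d => ‖(x : CBI.E d)‖) (Pr.map (X s)) :=
    fun s => (CBI.exists_integral_norm_le hS hm hν h0 s).elim fun _ h => (h s le_rfl).1
  have hcoe : Measurable fun x : CBI.Orthant d => (x : CBI.E d) := measurable_subtype_coe
  have hint : ∀ t, Integrable (fun ω => (X t ω : CBI.E d)) Pr := fun t =>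
    (integrable_norm_iff (hcoe.comp (hM.measurable t)).aestronglyMeasurable).1
      ((hnorm t).comp_measurable (hM.measurable t))
  have hcoord : ∀ t i, (∫ ω, (X t ω : CBI.E d) ∂Pr) i
      = ∫ x : CBI.Orthant d, (x : CBI.E d) i ∂(Pr.map (X t)) := fun t i => by
    rw [integral_map (hM.measurable t).aemeasurable
      (CBI.integrable_coord_of_norm i (hnorm t)).aestronglyMeasurable]
    exact ((EuclideanSpace.proj i : CBI.E d →L[ℝ] ℝ).integral_comp_comm (hint t)).symm
  refine ⟨fun t => ⟨hint t, ?_⟩, fun t => ?_⟩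
  · have h := CBI.eq_variation_of_constants p.BTilde p.βTilde
      (fun s i => ∫ x : CBI.Orthant d, (x : CBI.E d) i ∂(Pr.map (X s)))
      (fun s i => (CBI.integral_coord_sub hS hm hν h0 s i).1)
      (fun s i => (CBI.integral_coord_sub hS hm hν h0 s i).2) t
    simp only [← hcoord] at h
    ext i
    exact congrFun h i
  · have h := CBI.intervalIntegrable_integral_norm hS hm hν h0 t
    have hmap : ∀ s, ∫ x : CBI.Orthant d, ‖(x : CBI.E d)‖ ∂(Pr.map (X s))
        = ∫ ω, ‖(X s ω : CBI.E d)‖ ∂Pr := fun s =>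
      integral_map (hM.measurable s).aemeasurable (hnorm s).aestronglyMeasurable
    simpa only [hmap] using h
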